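/- Let $M$ be a smooth (Hausdorff, finite-dimensional) manifold without boundary, $\nabla$ a smooth torsion-free linear connection on $M$, and $\hbar$ a nonzero real constant. Let $C^\infty(M)$ be the ring of smooth complex-valued functions on $M$ and, for $x\in M$, let $\mathfrak m_x\subset C^\infty(M)$ be the ideal of functions vanishing at $x$. A linear differential operator of order $r$ (i.e. of order at most $r$) is a $\mathbb C$-linear map $P\colon C^\infty(M)\to C^\infty(M)$ with $P(\mathfrak m_x^{r+1})\subset\mathfrak m_x$ for every $x\in M$; a linear differential operator is one of some order $r\ge 0$. Tensor fields are smooth, with complex coefficients; a not necessarily homogeneous symmetric contravariant tensor field is a finite sum $\Phi=\sum_j\Phi_j$ of symmetric contravariant tensor fields $\Phi_j$ of order $j$. For a differential operator $P$ of order $r$, its symbol of order $r$ is the symmetric contravariant tensor field $\sigma^r(P)$ of order $r$ such that $\langle\sigma^r(P)_x,d^r_xf\rangle=(Pf)(x)$ for all $x\in M$ and $f\in\mathfrak m_x^r$, where $d_x^rf$ is the tensor of $r$-th partial derivatives of $f$ at $x$ in local coordinates (independent of the coordinates for such $f$) and $\langle\ ,\ \rangle$ is tensor contraction. For a symmetric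 contravariant tensor field $\Phi$ of order $r$ put $\widehat\Phi(f)=(-i\hbar)^r\langle\Phi,\nabla^r_{\mathrm{sym}}f\rangle$ for $f\in C^\infty(M)$, where $\nabla^r_{\mathrm{sym}}f$ is the symmetrization of the $r$-th iterated covariant differential of $f$; for a non-homogeneous $\Phi$ put $\widehat\Phi=\sum_j\widehat{\Phi_j}$. Then every differential operator of order $r$ has exactly one symbol of order $r$, and $\Phi\mapsto\widehat\Phi$ is a ($\mathbb C$-linear) bijection from the not necessarily homogeneous symmetric contravariant tensor fields on $M$ onto the linear differential operators on $C^\infty(M)$. If $P$ is of order $r$, the tensor $\Phi$ with $\widehat\Phi=P$ has the form $\Phi=\Phi_r+\Phi_{r-1}+\cdots+\Phi_0$ with $$\sigma^r(P)=(-i\hbar)^r\Phi_r,$$ for $k=1,\dots,r$ the operator $P-\widehat\Phi_r-\cdots-\widehat\Phi_{r-k+1}$ is of order $r-k$ and $$\sigma^{r-k}\bigl(P-\widehat\Phi_r-\cdots-\widehat\Phi_{r-k+1}\bigr)=(-i\hbar)^{r-k}\Phi_{r-k},$$ and $$P=\widehat\Phi=\widehat\Phi_r+\widehat\Phi_{r-1}+\cdots+\widehat\Phi_0.$$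 -/

import Mathlib

open scoped Manifold ContDiff DirectSum

noncomputable section

/-! ### Smooth complex functions and differential operators -/

/-- `C^∞(M)`: the `ℂ`-algebra of smooth complex-valued functions on `M`. -/
def SmoothFun (E : Type*) [NormedAddCommGroup E] [NormedSpace ℝ E]
    (M : Type*) [TopologicalSpace M] [ChartedSpace E M] : Subalgebra ℂ (M → ℂ) where
  carrier := {f | ContMDiff 𝓘(ℝ, E) 𝓘(ℝ, ℂ) ∞ f}
  mul_mem' {f g} hf hg := by
    have h : ContDiff ℝ ∞ (fun p : ℂ × ℂ => p.1 * p.2) := contDiff_fst.mul contDiff_snd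
    exact h.contMDiff.comp (hf.prodMk_space hg)
  add_mem' {f g} hf hg := by
    have h : ContDiff ℝ ∞ (fun p : ℂ × ℂ => p.1 + p.2) := contDiff_fst.add contDiff_snd
    exact h.contMDiff.comp (hf.prodMk_space hg)
  algebraMap_mem' c := contMDiff_const

section Operators

variable {E : Type*} [NormedAddCommGroup E] [NormedSpace ℝ E]
  {M : Type*} [TopologicalSpace M] [ChartedSpace E M]

/-- The ideal `m_x` of the smooth functions vanishing at `x`. -/
def vanishingIdeal (x : M) : Ideal (SmoothFun E M) where
  carrier := {f | (f : M → ℂ) x = 0}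
  add_mem' {f g} hf hg := by
    change (f : M → ℂ) x + (g : M → ℂ) x = 0
    rw [show (f : M → ℂ) x = 0 from hf, show (g : M → ℂ) x = 0 from hg, add_zero]
  zero_mem' := rfl
  smul_mem' f g hg := by
    change (f : M → ℂ) x * (g : M → ℂ) x = 0
    rw [show (g : M → ℂ) x = 0 from hg, mul_zero]

/-- `P` is a differential operator of order `r` (that is, of order at most `r`):
it takes `m_x ^ (r + 1)` into `m_x` for every point `x`. -/
def IsDiffOpOfOrder (r : ℕ) (P : Module.End ℂ (SmoothFun E M)) : Prop :=
  ∀ x : M, ∀ f ∈ (vanishingIdeal x : Ideal (SmoothFun E M)) ^ (r + 1), P f ∈ vanishingIdeal x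

theorem IsDiffOpOfOrder.mono {r s : ℕ} (hrs : r ≤ s) {P : Module.End ℂ (SmoothFun E M)}
    (hP : IsDiffOpOfOrder r P) : IsDiffOpOfOrder s P :=
  fun x f hf => hP x f (Ideal.pow_le_pow_right (Nat.succ_le_succ hrs) hf)

/-- The `ℂ`-vector space of linear differential operators (of arbitrary finite order). -/
def DiffOp (E : Type*) [NormedAddCommGroup E] [NormedSpace ℝ E]
    (M : Type*) [TopologicalSpace M] [ChartedSpace E M] :
    Submodule ℂ (Module.End ℂ (SmoothFun E M)) where
  carrier := {P | ∃ r, IsDiffOpOfOrder r P}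
  add_mem' := by
    rintro P Q ⟨r, hP⟩ ⟨s, hQ⟩
    refine ⟨max r s, fun x f hf => ?_⟩
    exact Ideal.add_mem _ (hP.mono (le_max_left r s) x f hf) (hQ.mono (le_max_right r s) x f hf)
  zero_mem' := ⟨0, fun x _ _ => Ideal.zero_mem (vanishingIdeal x)⟩
  smul_mem' := by
    rintro c P ⟨r, hP⟩
    refine ⟨r, fun x f hf => ?_⟩
    change c * (P f : M → ℂ) x = 0
    rw [show (P f : M → ℂ) x = 0 from hP x f hf, mul_zero]

end Operators

/-! ### Symmetric contravariant tensor fields -/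

/-- The `ℂ`-vector space of smooth symmetric contravariant tensor fields of order `r` on `M`, with
complex coefficients. Such a tensor at `x` is a symmetric `ℝ`-multilinear map
`T*_x M × ⋯ × T*_x M → ℂ`. The field `Φ` is smooth when `Φ(df₁, …, df_r)` is a smooth function
for all smooth real functions `f₁, …, f_r` on `M`. -/
def SymTensorField (E : Type*) [NormedAddCommGroup E] [NormedSpace ℝ E]
    (M : Type*) [TopologicalSpace M] [ChartedSpace E M] (r : ℕ) :
    Submodule ℂ (∀ x : M,
      MultilinearMap ℝ (fun _ : Fin r => Module.Dual ℝ (TangentSpace 𝓘(ℝ, E) x)) ℂ) where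
  carrier := {Φ |
    (∀ (x : M) (s : Equiv.Perm (Fin r)) (α : Fin r → Module.Dual ℝ (TangentSpace 𝓘(ℝ, E) x)),
      Φ x (fun i => α (s i)) = Φ x α) ∧
    ∀ f : Fin r → M → ℝ, (∀ i, ContMDiff 𝓘(ℝ, E) 𝓘(ℝ, ℝ) ∞ (f i)) →
      ContMDiff 𝓘(ℝ, E) 𝓘(ℝ, ℂ) ∞
        (fun x => Φ x (fun i => (mvfderiv 𝓘(ℝ, E) (f i) x).toLinearMap))}
  add_mem' hΦ hΨ :=
    ⟨fun x s α => congrArg₂ (· + ·) (hΦ.1 x s α) (hΨ.1 x s α),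
      fun f hf => (SmoothFun E M).add_mem (hΦ.2 f hf) (hΨ.2 f hf)⟩
  zero_mem' := ⟨fun _ _ _ => rfl, fun _ _ => contMDiff_const⟩
  smul_mem' c _ hΦ :=
    ⟨fun x s α => congrArg (c • ·) (hΦ.1 x s α),
      fun f hf => (SmoothFun E M).smul_mem (hΦ.2 f hf) c⟩

/-! ### Tensor contraction and symmetrization at a point -/

section Pointwise

variable {V : Type*} [AddCommGroup V] [Module ℝ V] {r : ℕ}

/-- The full contraction `⟨Φ, A⟩` of a contravariant tensor `Φ` and a covariant tensor `A` of the
same order `r`, computed in a basis `e` of `V` with dual basis `e*`: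
`∑ Φ(e*_{j₁}, …, e*_{j_r}) A(e_{j₁}, …, e_{j_r})`. For multilinear `A` the choice of the basis is
immaterial. -/
def contraction [FiniteDimensional ℝ V]
    (Φ : MultilinearMap ℝ (fun _ : Fin r => Module.Dual ℝ V) ℂ) (A : (Fin r → V) → ℂ) : ℂ :=
  ∑ J : Fin r → Fin (Module.finrank ℝ V),
    Φ (fun i => (Module.finBasis ℝ V).coord (J i)) * A (fun i => Module.finBasis ℝ V (J i))

/-- The symmetrization of a covariant tensor. -/
def symmetrization (A : (Fin r → V) → ℂ) (v : Fin r → V) : ℂ :=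
  (r.factorial : ℂ)⁻¹ * ∑ s : Equiv.Perm (Fin r), A (fun i => v (s i))

end Pointwise

/-! ### Iterated covariant differentials, quantization, symbols -/

section Manifold

variable {E : Type*} [NormedAddCommGroup E] [NormedSpace ℝ E]
  {M : Type*} [TopologicalSpace M] [ChartedSpace E M]

instance tangentSpaceFiniteDimensional [FiniteDimensional ℝ E] (x : M) :
    FiniteDimensional ℝ (TangentSpace 𝓘(ℝ, E) x) :=
  inferInstanceAs (FiniteDimensional ℝ E)

variable [IsManifold 𝓘(ℝ, E) ∞ M]

/-- The `r`-th iterated covariant differential `∇^r f`, as a map on `r`-tuples of vector fields: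
`∇^0 f = f` and `(∇^{r+1} f)(X₀, X₁, …, X_r)` is
`X₀ ((∇^r f)(X₁, …, X_r)) - ∑ i, (∇^r f)(X₁, …, ∇_{X₀} X_i, …, X_r)`. -/
def iteratedCovDeriv (cov : CovariantDerivative 𝓘(ℝ, E) E (TangentSpace 𝓘(ℝ, E) : M → Type _))
    (f : M → ℂ) : (r : ℕ) → (Fin r → ∀ x : M, TangentSpace 𝓘(ℝ, E) x) → M → ℂ
  | 0, _, x => f x
  | r + 1, X, x =>
      mvfderiv 𝓘(ℝ, E) (iteratedCovDeriv cov f r (fun i => X i.succ)) x (X 0 x)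
        - ∑ i : Fin r, iteratedCovDeriv cov f r
            (Function.update (fun j : Fin r => X j.succ) i (fun y => cov (X i.succ) y (X 0 y))) x

/-- The covariant tensor `∇^r_x f` at the point `x`, evaluated on tangent vectors at `x`. Since
`∇^r f` is tensorial, the vectors may be extended to arbitrary vector fields smooth near `x`;
here they are extended with constant coefficients in the chart at `x`. -/
def iteratedCovDerivAt
    (cov : CovariantDerivative 𝓘(ℝ, E) E (TangentSpace 𝓘(ℝ, E) : M → Type _))
    (f : M → ℂ) (r : ℕ) (x : M) (v : Fin r → TangentSpace 𝓘(ℝ, E) x) : ℂ :=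
  iteratedCovDeriv cov f r (fun i => FiberBundle.extend E (v i)) x

/-- The quantized of a symmetric contravariant tensor field `Φ` of order `r`, applied to `f`:
`Φ̂(f) = (-iħ)^r ⟨Φ, ∇^r_sym f⟩`. -/
def quantized [FiniteDimensional ℝ E]
    (cov : CovariantDerivative 𝓘(ℝ, E) E (TangentSpace 𝓘(ℝ, E) : M → Type _)) (ħ : ℝ)
    {r : ℕ} (Φ : SymTensorField E M r) (f : SmoothFun E M) (x : M) : ℂ :=
  (-Complex.I * (ħ : ℂ)) ^ r *
    contraction (Φ.1 x) (symmetrization (iteratedCovDerivAt cov (f : M → ℂ) r x))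

/-- The tensor `d^r_x f` of the `r`-th partial derivatives of `f` at `x`, in the chart at `x`
(the one through which Mathlib identifies `T_x M` with `E`). For `f ∈ m_x ^ r` it does not depend
on the chart. -/
def iteratedDiffAt (f : M → ℂ) (r : ℕ) (x : M) (v : Fin r → TangentSpace 𝓘(ℝ, E) x) : ℂ :=
  iteratedFDeriv ℝ r (f ∘ (chartAt E x).symm) (chartAt E x x) v

/-- `S` is the symbol of order `r` of the operator `P` of order `r`: at each point `x` the
contraction of `S_x` with the tensor `d^r_x f` representing the class of `f ∈ m_x ^ r`
modulo `m_x ^ (r + 1)` is `(P f)(x)`. -/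
def HasSymbol [FiniteDimensional ℝ E] (r : ℕ) (P : Module.End ℂ (SmoothFun E M))
    (S : SymTensorField E M r) : Prop :=
  IsDiffOpOfOrder r P ∧
    ∀ x : M, ∀ f ∈ (vanishingIdeal x : Ideal (SmoothFun E M)) ^ r,
      (P f : M → ℂ) x = contraction (S.1 x) (iteratedDiffAt (f : M → ℂ) r x)

end Manifold

end

/-! The filtration of smooth functions by the powers of `m_x` carries the proof. By Hadamard's lemma
a function in `m_x` is a linear combination of coordinate functions modulo `m_x ^ 2`, so products of
`r` coordinate functions span `m_x ^ r` modulo `m_x ^ (r + 1)`. The differential `d^r` of such a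
product at `x` is the sum, over permutations, of the tensor products of the covectors. Hence the
functional `f ↦ (P f)(x)` on `m_x ^ r` is contraction with exactly one symmetric tensor, whose value
on covectors is `P` of the product of their coordinate functions at `x`, divided by `r!`
(`contractDiff_prod_covectorFun`, `eq_zero_of_mem_pow`). Smoothness of the symbol follows by
replacing coordinate functions with `f_i - f_i(x)`, which changes the product only by an element of
`m_x ^ (r + 1)` (`symbolAt_mem`).

In a chart, `∇^r f` is `d^r f` plus terms with fewer derivatives of `f`, whose coefficients come
from the Christoffel symbols. So at `x` it equals `d^r f` on `m_x ^ r` and is zero on `m_x ^ (r +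
1)`: the quantized of `Φ` has order `r` and symbol `(-iħ)^r Φ` (`hasSymbol_quantizedOp`).

The rest is triangular descent. An operator whose symbol of order `r` is zero has order `r - 1`, or
is zero if `r = 0`. As `ħ ≠ 0`, the symbol of `P` can be cancelled by a quantized tensor, and
induction on `r` gives surjectivity. Conversely the top symbol of a sum of quantized tensors sees
only the top component, which gives injectivity and the recursive formulas. -/

open scoped Manifold ContDiff DirectSum

noncomputable section

set_option linter.unusedSectionVars false

/-! ### Calculus in a normed space -/

section Calculus

open MeasureTheory Set

variable {E : Type*} [NormedAddCommGroup E] [NormedSpace ℝ E]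
  {F : Type*} [NormedAddCommGroup F] [NormedSpace ℝ F]
  {G : Type*} [NormedAddCommGroup G] [NormedSpace ℝ G]
  {H : Type*} [NormedAddCommGroup H] [NormedSpace ℝ H]

/-- An integral over `[0, 1]` depending smoothly on a parameter is smooth. -/
theorem ContDiff.integral_Ioc_zero_one [CompleteSpace F] {g : E → ℝ → F}
    (hg : ContDiff ℝ ∞ (fun q : E × ℝ => g q.1 q.2)) :
    ContDiff ℝ ∞ (fun y => ∫ t in Ioc (0 : ℝ) 1, g y t) := by
  -- The integral is the value at `0` of the convolution of the indicator of `(0, 1]` with `t ↦ β t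
  -- • g y (-t)`. The reflection undoes the sign in the convolution; the bump is `1` on `[-1, 1]`
  -- and supplies the compact support required for smoothness in the parameter.
  let β : ContDiffBump (0 : ℝ) := ⟨1, 2, one_pos, one_lt_two⟩
  have hsm : ContDiffOn ℝ ∞ (↿fun (y : E) (t : ℝ) => β t • g y (-t)) (univ ×ˢ univ) := by
    apply ContDiff.contDiffOn
    have h1 : ContDiff ℝ ∞ (fun q : E × ℝ => β q.2) := β.contDiff.comp contDiff_snd
    have h2 : ContDiff ℝ ∞ (fun q : E × ℝ => g q.1 (-q.2)) :=
      hg.comp (contDiff_fst.prodMk contDiff_snd.neg)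
    exact h1.smul h2
  have hloc : LocallyIntegrable (indicator (Ioc (0 : ℝ) 1) (fun _ => (1 : ℝ))) volume :=
    ((integrable_indicator_iff measurableSet_Ioc).2
      (integrableOn_const (by simp))).locallyIntegrable
  have key := contDiffOn_convolution_right_with_param (μ := volume)
    (ContinuousLinearMap.lsmul ℝ ℝ) isOpen_univ (isCompact_closedBall (0 : ℝ) 2)
    (g := fun (y : E) (t : ℝ) => β t • g y (-t))
    (fun y t _ ht => by
      have : β t = 0 := by
        rw [← Function.notMem_support, β.support_eq]
        exact fun h => ht (Metric.ball_subset_closedBall h)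
      simp [this]) hloc hsm
  rw [univ_prod_univ, contDiffOn_univ] at key
  convert! key.comp (contDiff_id.prodMk contDiff_const : ContDiff ℝ ∞ fun y : E => (y, (0 : ℝ)))
    using 2 with y
  simp only [convolution_def]
  rw [← integral_indicator measurableSet_Ioc]
  congr 1 with t
  by_cases ht : t ∈ Ioc (0 : ℝ) 1
  · have : β (-t) = 1 := β.one_of_mem_closedBall (by
      simp only [mem_closedBall_zero_iff, norm_neg, Real.norm_eq_abs]
      rw [abs_of_pos ht.1]; exact ht.2)
    simp [ht, this]
  · simp [ht]

/-- Hadamard's lemma, first order. -/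
theorem ContDiff.exists_sub_eq_apply_sub [CompleteSpace F] {f : E → F} (hf : ContDiff ℝ ∞ f)
    (p : E) : ∃ g : E → E →L[ℝ] F, ContDiff ℝ ∞ g ∧ g p = fderiv ℝ f p ∧
      ∀ y, f y - f p = g y (y - p) := by
  have hf' : ContDiff ℝ ∞ (fderiv ℝ f) := hf.fderiv_right (by simp)
  have hjoint : ContDiff ℝ ∞ (fun q : E × ℝ => fderiv ℝ f (p + q.2 • (q.1 - p))) :=
    hf'.comp (by fun_prop)
  -- The witness is the mean of the derivative along the segment from `p` to `y`.
  refine ⟨fun y => ∫ t in Ioc (0 : ℝ) 1, fderiv ℝ f (p + t • (y - p)),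
    ContDiff.integral_Ioc_zero_one (g := fun y t => fderiv ℝ f (p + t • (y - p))) hjoint, ?_, ?_⟩
  · simp
  intro y
  have hc : Continuous (fun t : ℝ => fderiv ℝ f (p + t • (y - p))) :=
    hf'.continuous.comp (by fun_prop)
  rw [ContinuousLinearMap.integral_apply
    (hc.integrableOn_Icc.mono_set Ioc_subset_Icc_self),
    ← intervalIntegral.integral_of_le zero_le_one]
  have hd : ∀ t ∈ uIcc (0 : ℝ) 1, HasDerivAt (fun t : ℝ => f (p + t • (y - p)))
      (fderiv ℝ f (p + t • (y - p)) (y - p)) t := by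
    intro t _
    have h1 : HasFDerivAt f (fderiv ℝ f (p + t • (y - p))) (p + t • (y - p)) :=
      (hf.differentiable (by simp)).differentiableAt.hasFDerivAt
    have h2 : HasDerivAt (fun t : ℝ => p + t • (y - p)) (y - p) t := by
      simpa using ((hasDerivAt_id t).smul_const (y - p)).const_add p
    exact h1.comp_hasDerivAt t h2
  rw [intervalIntegral.integral_eq_sub_of_hasDerivAt hd
    ((hc.clm_apply continuous_const).intervalIntegrable _ _)]
  simp

/-- Multiplication by a bump supported in `s`. It allows Hadamard's lemma, which integrates along
segments in the whole space, to be applied to functions defined only on a chart. -/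
theorem ContDiffOn.exists_contDiff_eventuallyEq [FiniteDimensional ℝ E] {f : E → F} {s : Set E}
    {p : E} (hf : ContDiffOn ℝ ∞ f s) (hs : IsOpen s) (hp : p ∈ s) :
    ∃ g : E → F, ContDiff ℝ ∞ g ∧ g =ᶠ[nhds p] f := by
  obtain ⟨ε, hε, hball⟩ := Metric.nhds_basis_closedBall.mem_iff.1 (hs.mem_nhds hp)
  let β : ContDiffBump p := ⟨ε / 2, ε, half_pos hε, half_lt_self hε⟩
  refine ⟨fun y => β y • f y, ?_, ?_⟩
  · rw [← contMDiff_iff_contDiff]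
    refine contMDiff_of_tsupport fun y hy => ContDiffAt.contMDiffAt ?_
    have hys : y ∈ s := by
      have := tsupport_smul_subset_left β f hy
      rw [β.tsupport_eq] at this
      exact hball this
    exact β.contDiff.contDiffAt.smul (hf.contDiffAt (hs.mem_nhds hys))
  · filter_upwards [β.eventuallyEq_one] with y hy
    simp only [Pi.one_apply] at hy
    simp [hy]

/-- `f` vanishes to order `n` at `p`: its derivatives of order less than `n` are zero at `p`. -/
def VanishesTo (n : ℕ) (f : E → F) (p : E) : Prop :=
  ∀ j < n, iteratedFDeriv ℝ j f p = 0

theorem VanishesTo.mono {m n : ℕ} {f : E → F} {p : E} (h : VanishesTo n f p) (hmn : m ≤ n) :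
    VanishesTo m f p :=
  fun j hj => h j (hj.trans_le hmn)

theorem VanishesTo.eq_zero {n : ℕ} {f : E → F} {p : E} (h : VanishesTo n f p) (hn : 0 < n) :
    f p = 0 := by
  have := congrArg (fun A => A (fun _ => 0)) (h 0 hn)
  simpa using this

theorem vanishesTo_one {f : E → F} {p : E} (h : f p = 0) : VanishesTo 1 f p := by
  intro j hj
  obtain rfl : j = 0 := by omega
  ext v
  simpa using h

theorem VanishesTo.congr {n : ℕ} {f g : E → F} {p : E} (h : VanishesTo n f p)
    (hfg : f =ᶠ[nhds p] g) : VanishesTo n g p :=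
  fun j hj => (hfg.iteratedFDeriv ℝ j).self_of_nhds.symm.trans (h j hj)

theorem VanishesTo.fderiv {n : ℕ} {f : E → F} {p : E} (h : VanishesTo (n + 1) f p) :
    VanishesTo n (fderiv ℝ f) p := by
  intro j hj
  rw [← norm_eq_zero, norm_iteratedFDeriv_fderiv, h (j + 1) (by omega), norm_zero]

theorem VanishesTo.comp_linearIsometryEquiv {n : ℕ} {f : E → F} {p : E} (h : VanishesTo n f p)
    (e : F ≃ₗᵢ[ℝ] G) : VanishesTo n (fun y => e (f y)) p := by
  intro j hj
  have := e.norm_iteratedFDeriv_comp_left (𝕜 := ℝ) f p j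
  rw [h j hj, norm_zero, norm_eq_zero] at this
  exact this

theorem VanishesTo.add {n : ℕ} {f g : E → F} {p : E} (hf : VanishesTo n f p)
    (hg : VanishesTo n g p) (hfs : ContDiffAt ℝ ∞ f p) (hgs : ContDiffAt ℝ ∞ g p) :
    VanishesTo n (fun y => f y + g y) p := by
  intro j hj
  rw [fun_iteratedFDeriv_add_apply (hfs.of_le (mod_cast le_top)) (hgs.of_le (mod_cast le_top)),
    hf j hj, hg j hj, add_zero]

theorem VanishesTo.neg {n : ℕ} {f : E → F} {p : E} (hf : VanishesTo n f p) :
    VanishesTo n (fun y => -f y) p := by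
  intro j hj
  change iteratedFDeriv ℝ j (-f) p = 0
  rw [iteratedFDeriv_neg, Pi.neg_apply, hf j hj, neg_zero]

theorem VanishesTo.sub {n : ℕ} {f g : E → F} {p : E} (hf : VanishesTo n f p)
    (hg : VanishesTo n g p) (hfs : ContDiffAt ℝ ∞ f p) (hgs : ContDiffAt ℝ ∞ g p) :
    VanishesTo n (fun y => f y - g y) p := by
  simpa only [sub_eq_add_neg] using hf.add hg.neg hfs hgs.neg

/-- Orders of vanishing add up under a bilinear operation. -/
theorem VanishesTo.bilinear {a b : ℕ} (B : F →L[ℝ] G →L[ℝ] H) {f : E → F} {g : E → G} {s : Set E}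
    {p : E} (hf : VanishesTo a f p) (hg : VanishesTo b g p) (hfs : ContDiffOn ℝ ∞ f s)
    (hgs : ContDiffOn ℝ ∞ g s) (hs : IsOpen s) (hp : p ∈ s) :
    VanishesTo (a + b) (fun y => B (f y) (g y)) p := by
  intro j hj
  -- Leibniz bound: the `j`-th derivative is controlled by products of the `i`-th derivative of `f`
  -- and the `(j - i)`-th of `g`. Since `j < a + b`, either `i < a` or `j - i < b`, and every
  -- product vanishes.
  have hb := B.norm_iteratedFDerivWithin_le_of_bilinear hfs hgs hs.uniqueDiffOn hp (n := j)
    (mod_cast le_top)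
  rw [iteratedFDerivWithin_of_isOpen j hs hp] at hb
  rw [← norm_le_zero_iff]
  refine hb.trans (le_of_eq ?_)
  rw [Finset.sum_eq_zero, mul_zero]
  intro i hi
  rw [iteratedFDerivWithin_of_isOpen i hs hp, iteratedFDerivWithin_of_isOpen (j - i) hs hp]
  rcases lt_or_ge i a with h | h
  · simp [hf i h]
  · rw [hg (j - i) (by have := Finset.mem_range.1 hi; omega)]
    simp

theorem vanishesTo_zero (f : E → F) (p : E) : VanishesTo 0 f p := fun _ hj => by omega

/-- The derivative of order `r` at `p` of a product of `r` linear forms centred at `p`. -/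
theorem iteratedFDeriv_prod_linear {r : ℕ} (a : Fin r → E →L[ℝ] ℂ) (p : E) (v : Fin r → E) :
    iteratedFDeriv ℝ r (fun y => ∏ i, a i (y - p)) p v = ∑ s : Equiv.Perm (Fin r),
      ∏ i, a i (v (s i)) := by
  let A : ContinuousMultilinearMap ℝ (fun _ : Fin r => E) ℂ :=
    (ContinuousMultilinearMap.mkPiAlgebra ℝ (Fin r) ℂ).compContinuousLinearMap a
  have h := iteratedFDeriv_comp_sub (𝕜 := ℝ) (f := fun y : E => ∏ i, a i y) r p p
  rw [h]
  have := A.iteratedFDeriv_comp_diagonal (p - p) v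
  simpa [A] using this

end Calculus

/-! ### Smooth functions near a point -/

section LocalFunctions

variable {E : Type*} [NormedAddCommGroup E] [NormedSpace ℝ E]
  {M : Type*} [TopologicalSpace M] [ChartedSpace E M]

theorem mem_vanishingIdeal {x : M} {f : SmoothFun E M} :
    f ∈ vanishingIdeal x ↔ (f : M → ℂ) x = 0 := Iff.rfl

theorem SmoothFun.smooth (f : SmoothFun E M) : ContMDiff 𝓘(ℝ, E) 𝓘(ℝ, ℂ) ∞ (f : M → ℂ) := f.2

/-- Evaluation of smooth functions at a point. -/
def SmoothFun.eval (x : M) : SmoothFun E M →ₗ[ℂ] ℂ where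
  toFun f := (f : M → ℂ) x
  map_add' _ _ := rfl
  map_smul' _ _ := rfl

theorem SmoothFun.sub_eval_mem (f : SmoothFun E M) (x : M) :
    f - algebraMap ℂ (SmoothFun E M) ((f : M → ℂ) x) ∈ vanishingIdeal x := by
  change (f : M → ℂ) x - (f : M → ℂ) x = 0
  exact sub_self _

theorem SmoothFun.prod_apply {ι : Type*} (s : Finset ι) (f : ι → SmoothFun E M) (y : M) :
    ((∏ i ∈ s, f i : SmoothFun E M) : M → ℂ) y = ∏ i ∈ s, (f i : M → ℂ) y := by
  rw [SubmonoidClass.coe_finsetProd, Finset.prod_apply]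

theorem SmoothFun.sum_apply {ι : Type*} (s : Finset ι) (f : ι → SmoothFun E M) (y : M) :
    ((∑ i ∈ s, f i : SmoothFun E M) : M → ℂ) y = ∑ i ∈ s, (f i : M → ℂ) y := by
  rw [AddSubmonoidClass.coe_finsetSum, Finset.sum_apply]

section Chart

variable {F : Type*} [NormedAddCommGroup F] [NormedSpace ℝ F]

omit [NormedSpace ℝ E] in
theorem chartAt_mem_target (x : M) : chartAt E x x ∈ (chartAt E x).target :=
  (chartAt E x).map_source (mem_chart_source E x)

omit [NormedSpace ℝ E] in
theorem Filter.EventuallyEq.comp_chart_symm {β : Type*} {x : M} {f g : M → β}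
    (h : f =ᶠ[nhds x] g) :
    f ∘ (chartAt E x).symm =ᶠ[nhds (chartAt E x x)] g ∘ (chartAt E x).symm := by
  have hc : Filter.Tendsto (chartAt E x).symm (nhds (chartAt E x x)) (nhds x) := by
    have := (chartAt E x).continuousAt_symm (chartAt_mem_target x)
    rwa [ContinuousAt, (chartAt E x).left_inv (mem_chart_source E x)] at this
  exact hc.eventually h

variable [FiniteDimensional ℝ E]

/-- A smooth function on the model space, read in the chart at `x` and cut off near `x`. -/
def chartCutoff (x : M) (g : E → F) : M → F :=
  fun y => (Classical.arbitrary (SmoothBumpFunction 𝓘(ℝ, E) x)) y • g (chartAt E x y)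

theorem chartCutoff_eventuallyEq (x : M) (g : E → F) :
    chartCutoff x g =ᶠ[nhds x] fun y => g (chartAt E x y) := by
  filter_upwards [SmoothBumpFunction.eventuallyEq_one
    (Classical.arbitrary (SmoothBumpFunction 𝓘(ℝ, E) x))] with y hy
  simp only [Pi.one_apply] at hy
  simp [chartCutoff, hy]

theorem chartCutoff_self (x : M) (g : E → F) : chartCutoff x g x = g (chartAt E x x) :=
  (chartCutoff_eventuallyEq x g).self_of_nhds

theorem chartCutoff_comp_chart_symm (x : M) (g : E → F) :
    chartCutoff x g ∘ (chartAt E x).symm =ᶠ[nhds (chartAt E x x)] g := by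
  refine (chartCutoff_eventuallyEq x g).comp_chart_symm.trans ?_
  filter_upwards [(chartAt E x).open_target.mem_nhds (chartAt_mem_target x)] with y hy
  simp [(chartAt E x).right_inv hy]

variable [IsManifold 𝓘(ℝ, E) ∞ M]

omit [FiniteDimensional ℝ E] in
theorem contMDiffOn_chart_symm' (x : M) :
    ContMDiffOn 𝓘(ℝ, E) 𝓘(ℝ, E) ∞ (chartAt E x).symm (chartAt E x).target :=
  contMDiffOn_chart_symm

omit [FiniteDimensional ℝ E] in
theorem ContMDiff.contDiffOn_comp_chart_symm {f : M → F} (hf : ContMDiff 𝓘(ℝ, E) 𝓘(ℝ, F) ∞ f)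
    (x : M) : ContDiffOn ℝ ∞ (f ∘ (chartAt E x).symm) (chartAt E x).target :=
  (hf.comp_contMDiffOn (contMDiffOn_chart_symm' x)).contDiffOn

omit [FiniteDimensional ℝ E] in
theorem ContMDiff.contDiffAt_comp_chart_symm {f : M → F} (hf : ContMDiff 𝓘(ℝ, E) 𝓘(ℝ, F) ∞ f)
    (x : M) : ContDiffAt ℝ ∞ (f ∘ (chartAt E x).symm) (chartAt E x x) :=
  (hf.contDiffOn_comp_chart_symm x).contDiffAt
    ((chartAt E x).open_target.mem_nhds (chartAt_mem_target x))

omit [FiniteDimensional ℝ E] in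
/-- A function vanishing at `x` to order `n` in the algebraic sense has vanishing derivatives of
order less than `n` in the chart at `x`. -/
theorem vanishesTo_of_mem_pow {x : M} {n : ℕ} {f : SmoothFun E M}
    (hf : f ∈ (vanishingIdeal x : Ideal (SmoothFun E M)) ^ n) :
    VanishesTo n ((f : M → ℂ) ∘ (chartAt E x).symm) (chartAt E x x) := by
  induction n generalizing f with
  | zero => exact vanishesTo_zero _ _
  | succ n ih =>
    rw [pow_succ] at hf
    refine Submodule.mul_induction_on hf (fun g hg h hh => ?_) (fun g h hg hh => ?_)
    · have h1 : VanishesTo 1 ((h : M → ℂ) ∘ (chartAt E x).symm) (chartAt E x x) := by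
        apply vanishesTo_one
        simpa [(chartAt E x).left_inv (mem_chart_source E x)] using mem_vanishingIdeal.1 hh
      exact (ih hg).bilinear (ContinuousLinearMap.mul ℝ ℂ) h1
        ((SmoothFun.smooth g).contDiffOn_comp_chart_symm x)
        ((SmoothFun.smooth h).contDiffOn_comp_chart_symm x)
        (chartAt E x).open_target (chartAt_mem_target x)
    · exact hg.add hh ((SmoothFun.smooth g).contDiffAt_comp_chart_symm x)
        ((SmoothFun.smooth h).contDiffAt_comp_chart_symm x)

variable [T2Space M]

theorem contMDiff_chartCutoff (x : M) {g : E → F} (hg : ContDiff ℝ ∞ g) :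
    ContMDiff 𝓘(ℝ, E) 𝓘(ℝ, F) ∞ (chartCutoff x g) :=
  SmoothBumpFunction.contMDiff_smul _
    (hg.contMDiff.comp_contMDiffOn (contMDiffOn_chart (I := 𝓘(ℝ, E)) (n := ∞) (x := x)))

/-- A smooth function which is zero near `x` lies in all powers of the ideal of `x`. -/
theorem mem_vanishingIdeal_pow_of_eventually {x : M} {f : SmoothFun E M}
    (hf : ∀ᶠ y in nhds x, (f : M → ℂ) y = 0) (n : ℕ) :
    f ∈ (vanishingIdeal x : Ideal (SmoothFun E M)) ^ n := by
  obtain ⟨χ, -, hχ⟩ := (SmoothBumpFunction.nhds_basis_support (I := 𝓘(ℝ, E)) hf).mem_iff.1 hf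
  -- The bump `χ` is supported where `f` vanishes and is `1` at `x`, so `c = 1 - χ` lies in the
  -- ideal and `f * c = f`; iterating, `f = f * c ^ n`.
  let c : SmoothFun E M := ⟨fun y => 1 - (χ y : ℂ),
    by
      have h : ContDiff ℝ ∞ (fun t : ℝ => (1 : ℂ) - (t : ℂ)) :=
        contDiff_const.sub Complex.ofRealCLM.contDiff
      exact h.contMDiff.comp χ.contMDiff⟩
  have hc : c ∈ vanishingIdeal x := by
    change 1 - (χ x : ℂ) = 0
    simp
  have hfc : f * c = f := by
    ext y
    change (f : M → ℂ) y * (1 - (χ y : ℂ)) = (f : M → ℂ) y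
    by_cases hy : y ∈ Function.support χ
    · rw [show (f : M → ℂ) y = 0 from hχ hy, zero_mul]
    · rw [Function.notMem_support.1 hy]
      simp
  have hpow : f * c ^ n = f := by
    induction n with
    | zero => simp
    | succ n ih => rw [pow_succ, ← mul_assoc, ih, hfc]
  rw [← hpow]
  exact Ideal.mul_mem_left _ _ (Ideal.pow_mem_pow hc n)

/-- The linear coordinate function with differential `α` at `x`, read in the chart at `x` and cut
off near `x`. -/
def coordFun (x : M) : Module.Dual ℝ E →ₗ[ℝ] SmoothFun E M where
  toFun α := ⟨chartCutoff x (fun y : E => ((α (y - chartAt E x x) : ℝ) : ℂ)), by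
    let β : E →L[ℝ] ℝ := LinearMap.toContinuousLinearMap (𝕜 := ℝ) (E := E) (F' := ℝ) α
    apply contMDiff_chartCutoff
    exact Complex.ofRealCLM.contDiff.comp
      (β.contDiff.comp (contDiff_id.sub (contDiff_const (c := chartAt E x x))))⟩
  map_add' α β := by
    ext y
    change chartCutoff x (fun y : E => (((α + β) (y - chartAt E x x) : ℝ) : ℂ)) y =
      chartCutoff x (fun y : E => ((α (y - chartAt E x x) : ℝ) : ℂ)) y +
        chartCutoff x (fun y : E => ((β (y - chartAt E x x) : ℝ) : ℂ)) y
    simp [chartCutoff]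
  map_smul' c α := by
    ext y
    change chartCutoff x (fun y : E => ((c * α (y - chartAt E x x) : ℝ) : ℂ)) y =
      c • chartCutoff x (fun y : E => ((α (y - chartAt E x x) : ℝ) : ℂ)) y
    simp only [chartCutoff, Complex.real_smul, Complex.ofReal_mul]
    ring

/-- The coordinate function with a given differential in the cotangent space at `x`. -/
def covectorFun (x : M) : Module.Dual ℝ (TangentSpace 𝓘(ℝ, E) x) →ₗ[ℝ] SmoothFun E M :=
  coordFun (E := E) x

theorem coordFun_eventuallyEq (x : M) (α : Module.Dual ℝ E) :
    (coordFun x α : M → ℂ) =ᶠ[nhds x] fun y => ((α (chartAt E x y - chartAt E x x) : ℝ) : ℂ) :=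
  chartCutoff_eventuallyEq x (fun y : E => ((α (y - chartAt E x x) : ℝ) : ℂ))

theorem coordFun_mem (x : M) (α : Module.Dual ℝ E) :
    coordFun x α ∈ vanishingIdeal x := by
  refine (coordFun_eventuallyEq x α).self_of_nhds.trans ?_
  simp

/-- Hadamard's lemma: modulo the square of the ideal of `x`, a smooth function vanishing at `x` is
its linear part. -/
theorem sub_sum_coordFun_mem_sq {x : M} {f : SmoothFun E M} (hf : f ∈ vanishingIdeal x) :
    f - ∑ j, fderiv ℝ ((f : M → ℂ) ∘ (chartAt E x).symm) (chartAt E x x)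
          (Module.finBasis ℝ E j) •
        coordFun x ((Module.finBasis ℝ E).coord j)
      ∈ (vanishingIdeal x : Ideal (SmoothFun E M)) ^ 2 := by
  obtain ⟨F, hF, hFf⟩ :=
    ((SmoothFun.smooth f).contDiffOn_comp_chart_symm x).exists_contDiff_eventuallyEq
      (chartAt E x).open_target (chartAt_mem_target x)
  obtain ⟨G, hG, hGp, hFG⟩ := hF.exists_sub_eq_apply_sub (chartAt E x x)
  set b := Module.finBasis ℝ E
  have hFp : F (chartAt E x x) = 0 := by
    rw [hFf.self_of_nhds, Function.comp_apply, (chartAt E x).left_inv (mem_chart_source E x)]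
    exact hf
  let g : Fin _ → SmoothFun E M := fun j =>
    ⟨chartCutoff x (fun y : E => G y (b j)), contMDiff_chartCutoff x (hG.clm_apply contDiff_const)⟩
  have hrem : f - ∑ j, coordFun x (b.coord j) * g j ∈
      (vanishingIdeal x : Ideal (SmoothFun E M)) ^ 2 := by
    apply mem_vanishingIdeal_pow_of_eventually
    have h1 : ∀ᶠ y in nhds x, F (chartAt E x y) = (f : M → ℂ) y := by
      have hc : Filter.Tendsto (chartAt E x) (nhds x) (nhds (chartAt E x x)) :=
        (chartAt E x).continuousAt (mem_chart_source E x)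
      filter_upwards [hc.eventually hFf, (chartAt E x).open_source.mem_nhds (mem_chart_source E x)]
        with y hy hys
      rw [hy, Function.comp_apply, (chartAt E x).left_inv hys]
    have h2 : ∀ᶠ y in nhds x, ∀ j, (coordFun x (b.coord j) : M → ℂ) y =
        ((b.coord j (chartAt E x y - chartAt E x x) : ℝ) : ℂ) :=
      Filter.eventually_all.2 fun j => coordFun_eventuallyEq x (b.coord j)
    have h3 : ∀ᶠ y in nhds x, ∀ j, (g j : M → ℂ) y = G (chartAt E x y) (b j) :=
      Filter.eventually_all.2 fun j => chartCutoff_eventuallyEq x (fun y : E => G y (b j))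
    filter_upwards [h1, h2, h3] with y hy1 hy2 hy3
    change (f : M → ℂ) y - ((∑ j, coordFun x (b.coord j) * g j : SmoothFun E M) : M → ℂ) y = 0
    rw [SmoothFun.sum_apply, sub_eq_zero, ← hy1, ← sub_zero (F _), ← hFp, hFG]
    have hexp := b.sum_repr (chartAt E x y - chartAt E x x)
    conv_lhs => rw [← hexp]
    rw [map_sum]
    refine Finset.sum_congr rfl fun j _ => ?_
    change _ = (coordFun x (b.coord j) : M → ℂ) y * (g j : M → ℂ) y
    rw [hy2, hy3]
    exact (map_smul (G (chartAt E x y)) _ _).trans (Complex.real_smul)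
  have hfd : fderiv ℝ ((f : M → ℂ) ∘ (chartAt E x).symm) (chartAt E x x) = G (chartAt E x x) := by
    rw [hGp, hFf.fderiv_eq]
  rw [hfd]
  -- Freezing each coefficient `g j` at its value at `x` costs the product of a coordinate function
  -- and `g j - g j (x)`, two elements of the ideal.
  have hsplit : f - ∑ j, G (chartAt E x x) (b j) • coordFun x (b.coord j) =
      (f - ∑ j, coordFun x (b.coord j) * g j) +
        ∑ j, coordFun x (b.coord j) *
          (g j - algebraMap ℂ (SmoothFun E M) ((g j : M → ℂ) x)) := by
    simp only [mul_sub, Finset.sum_sub_distrib]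
    rw [sub_add_sub_cancel]
    congr 1
    refine Finset.sum_congr rfl fun j _ => ?_
    rw [show (g j : M → ℂ) x = G (chartAt E x x) (b j) from
      chartCutoff_self x (fun y : E => G y (b j)), mul_comm,
      Algebra.smul_def]
  rw [hsplit]
  refine Ideal.add_mem _ hrem (Ideal.sum_mem _ fun j _ => ?_)
  rw [pow_two]
  exact Ideal.mul_mem_mul (coordFun_mem x _) (SmoothFun.sub_eval_mem _ x)

end Chart

end LocalFunctions

/-! ### Contraction -/

section Contraction

variable {V : Type*} [AddCommGroup V] [Module ℝ V] [FiniteDimensional ℝ V] {r : ℕ}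

/-- Expanding each covector in the dual basis and using multilinearity of `Φ` gives the defining
sum. Decomposable covariant tensors thus evaluate `Φ`. -/
theorem contraction_prod (Φ : MultilinearMap ℝ (fun _ : Fin r => Module.Dual ℝ V) ℂ)
    (α : Fin r → Module.Dual ℝ V) :
    contraction Φ (fun v => ∏ i, ((α i (v i) : ℝ) : ℂ)) = Φ α := by
  have h : α = fun i => ∑ j, α i (Module.finBasis ℝ V j) • (Module.finBasis ℝ V).coord j := by
    funext i
    exact ((Module.finBasis ℝ V).sum_dual_apply_smul_coord (α i)).symm
  conv_rhs => rw [h, MultilinearMap.map_sum]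
  refine Finset.sum_congr rfl fun J _ => ?_
  rw [MultilinearMap.map_smul_univ, Complex.real_smul, mul_comm]
  push_cast
  rfl

theorem contraction_sum {ι : Type*} (s : Finset ι)
    (Φ : MultilinearMap ℝ (fun _ : Fin r => Module.Dual ℝ V) ℂ) (A : ι → (Fin r → V) → ℂ) :
    contraction Φ (fun v => ∑ k ∈ s, A k v) = ∑ k ∈ s, contraction Φ (A k) := by
  simp only [contraction, Finset.mul_sum]
  exact Finset.sum_comm

theorem contraction_mul_left (Φ : MultilinearMap ℝ (fun _ : Fin r => Module.Dual ℝ V) ℂ) (c : ℂ)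
    (A : (Fin r → V) → ℂ) : contraction Φ (fun v => c * A v) = c * contraction Φ A := by
  simp only [contraction, Finset.mul_sum]
  exact Finset.sum_congr rfl fun J _ => by ring

theorem contraction_add (Φ : MultilinearMap ℝ (fun _ : Fin r => Module.Dual ℝ V) ℂ)
    (A B : (Fin r → V) → ℂ) :
    contraction Φ (fun v => A v + B v) = contraction Φ A + contraction Φ B := by
  simp only [contraction, mul_add, Finset.sum_add_distrib]

theorem add_contraction (Φ Ψ : MultilinearMap ℝ (fun _ : Fin r => Module.Dual ℝ V) ℂ)
    (A : (Fin r → V) → ℂ) :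
    contraction (Φ + Ψ) A = contraction Φ A + contraction Ψ A := by
  simp only [contraction, _root_.add_apply, add_mul, Finset.sum_add_distrib]

theorem smul_contraction (c : ℂ) (Φ : MultilinearMap ℝ (fun _ : Fin r => Module.Dual ℝ V) ℂ)
    (A : (Fin r → V) → ℂ) : contraction (c • Φ) A = c * contraction Φ A := by
  simp only [contraction, _root_.smul_apply, Finset.mul_sum, smul_eq_mul, mul_assoc]

/-- The contraction may be computed in any basis. -/
theorem contraction_eq_sum_basis {ι : Type*} [Fintype ι] (b : Module.Basis ι ℝ V)
    (Φ : MultilinearMap ℝ (fun _ : Fin r => Module.Dual ℝ V) ℂ)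
    (A : MultilinearMap ℝ (fun _ : Fin r => V) ℂ) :
    contraction Φ A = ∑ J : Fin r → ι, Φ (fun i => b.coord (J i)) * A (fun i => b (J i)) := by
  classical
  have h : (A : (Fin r → V) → ℂ) = fun v => ∑ J : Fin r → ι,
      A (fun i => b (J i)) * ∏ i, ((b.coord (J i) (v i) : ℝ) : ℂ) := by
    funext v
    have hv : v = fun i => ∑ j, b.coord j (v i) • b j := by
      funext i
      exact (b.sum_repr (v i)).symm
    conv_lhs => rw [hv, MultilinearMap.map_sum]
    refine Finset.sum_congr rfl fun J _ => ?_
    rw [MultilinearMap.map_smul_univ, Complex.real_smul, mul_comm]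
    push_cast
    rfl
  calc contraction Φ A = _ := congrArg (contraction Φ) h
    _ = _ := by
      rw [contraction_sum]
      refine Finset.sum_congr rfl fun J _ => ?_
      rw [contraction_mul_left, contraction_prod, mul_comm]

/-- A symmetric tensor does not see the symmetrization. -/
theorem contraction_symmetrization
    {Φ : MultilinearMap ℝ (fun _ : Fin r => Module.Dual ℝ V) ℂ}
    (hΦ : ∀ (s : Equiv.Perm (Fin r)) (α : Fin r → Module.Dual ℝ V),
      Φ (fun i => α (s i)) = Φ α) (A : (Fin r → V) → ℂ) :
    contraction Φ (symmetrization A) = contraction Φ A := by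
  have h : ∀ s : Equiv.Perm (Fin r), contraction Φ (fun v => A (fun i => v (s i))) =
      contraction Φ A := by
    intro s
    simp only [contraction]
    -- Permuting the index tuple moves the permutation from `A` to `Φ`, which absorbs it.
    rw [← (Equiv.arrowCongr s (Equiv.refl _)).sum_comp]
    refine Finset.sum_congr rfl fun J _ => ?_
    rw [← hΦ s]
    simp [Equiv.arrowCongr]
  have hs : symmetrization A = fun v => (r.factorial : ℂ)⁻¹ *
      ∑ s : Equiv.Perm (Fin r), A (fun i => v (s i)) := rfl
  rw [hs, contraction_mul_left, contraction_sum, Finset.sum_congr rfl fun s _ => h s]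
  simp only [Finset.sum_const, Finset.card_univ, Fintype.card_perm, Fintype.card_fin, nsmul_eq_mul]
  rw [← mul_assoc, inv_mul_cancel₀ (mod_cast r.factorial_ne_zero), one_mul]

end Contraction

/-! ### Symbols -/

section Symbols

variable {E : Type*} [NormedAddCommGroup E] [NormedSpace ℝ E] [FiniteDimensional ℝ E]
  {M : Type*} [TopologicalSpace M] [T2Space M] [ChartedSpace E M] [IsManifold 𝓘(ℝ, E) ∞ M]

/-- A linear functional vanishing on `m_x ^ (r + 1)` and on the products of `r` coordinate functions
vanishes on `m_x ^ r`. -/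
theorem eq_zero_of_mem_pow {x : M} {r : ℕ} (L : SmoothFun E M →ₗ[ℂ] ℂ)
    (hL : ∀ f ∈ (vanishingIdeal x : Ideal (SmoothFun E M)) ^ (r + 1), L f = 0)
    (hprod : ∀ α : Fin r → Module.Dual ℝ E, L (∏ i, coordFun x (α i)) = 0)
    {f : SmoothFun E M} (hf : f ∈ (vanishingIdeal x : Ideal (SmoothFun E M)) ^ r) : L f = 0 := by
  have hlist : ∀ l : List (Module.Dual ℝ E),
      (l.map (coordFun x)).prod ∈ (vanishingIdeal x : Ideal (SmoothFun E M)) ^ l.length := by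
    intro l
    induction l with
    | nil => simp
    | cons a l ih =>
      rw [List.map_cons, List.prod_cons, List.length_cons, pow_succ']
      exact Ideal.mul_mem_mul (coordFun_mem x a) ih
  -- Factors are made linear one at a time: `k` counts the factors still arbitrary in the ideal, and
  -- `l` collects the coordinate functions already extracted.
  have key : ∀ (k : ℕ) (l : List (Module.Dual ℝ E)), k + l.length = r →
      ∀ g ∈ (vanishingIdeal x : Ideal (SmoothFun E M)) ^ k,
        L (g * (l.map (coordFun x)).prod) = 0 := by
    intro k
    induction k with
    | zero =>
      intro l hl g _
      have hl' : l.length = r := by omega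
      subst hl'
      have hp : L (l.map (coordFun x)).prod = 0 := by
        have h := hprod l.get
        rw [← List.prod_ofFn] at h
        have h2 : List.ofFn (fun i => coordFun x (l.get i)) = l.map (coordFun x) := by
          conv_rhs => rw [← List.ofFn_get l]
          rw [List.map_ofFn]
          rfl
        rwa [h2] at h
      -- With no arbitrary factor left, only the constant `g(x)` matters: the rest of `g` lies in
      -- the ideal and pushes the product into `m_x ^ (r + 1)`.
      have hg : g = algebraMap ℂ _ ((g : M → ℂ) x) +
          (g - algebraMap ℂ (SmoothFun E M) ((g : M → ℂ) x)) := by abel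
      rw [hg, add_mul, map_add, ← Algebra.smul_def, map_smul, hp, smul_zero, zero_add]
      apply hL
      rw [pow_succ']
      exact Ideal.mul_mem_mul (SmoothFun.sub_eval_mem g x) (hlist l)
    | succ k ih =>
      intro l hl g hg
      rw [pow_succ] at hg
      refine Submodule.mul_induction_on hg (fun u hu h hh => ?_) (fun u v hu hv => ?_)
      · have hq := sub_sum_coordFun_mem_sq hh
        set w := ∑ j, fderiv ℝ ((h : M → ℂ) ∘ (chartAt E x).symm) (chartAt E x x)
          (Module.finBasis ℝ E j) • coordFun x ((Module.finBasis ℝ E).coord j) with hw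
        -- Here `w` is the linear part of `h`. The error `h - w` lies in the square of the ideal, so
        -- it raises the total order to `k + 2 + l.length = r + 1`.
        have hh' : h = w + (h - w) := by abel
        rw [hh', mul_add, add_mul, map_add]
        have h1 : L (u * (h - w) * (l.map (coordFun x)).prod) = 0 := by
          apply hL
          have h2 := Ideal.mul_mem_mul (Ideal.mul_mem_mul hu hq) (hlist l)
          rw [← pow_add, ← pow_add] at h2
          rwa [show r + 1 = k + 2 + l.length by omega]
        rw [h1, add_zero, hw, Finset.mul_sum, Finset.sum_mul, map_sum]
        refine Finset.sum_eq_zero fun j _ => ?_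
        rw [mul_smul_comm, smul_mul_assoc, map_smul, mul_assoc]
        have h3 := ih ((Module.finBasis ℝ E).coord j :: l) (by simp; omega) u hu
        rw [List.map_cons, List.prod_cons] at h3
        rw [h3, smul_zero]
      · rw [add_mul, map_add, hu, hv, add_zero]
  simpa using key r [] (by simp) f hf

/-- The differentials of order `r` at `x`, contracted with a tensor, as a linear functional. -/
def contractDiff {x : M} {r : ℕ}
    (S : MultilinearMap ℝ (fun _ : Fin r => Module.Dual ℝ (TangentSpace 𝓘(ℝ, E) x)) ℂ) :
    SmoothFun E M →ₗ[ℂ] ℂ where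
  toFun f := contraction S (iteratedDiffAt (E := E) (f : M → ℂ) r x)
  map_add' f g := by
    rw [← contraction_add]
    congr 1
    funext v
    have hf := ((SmoothFun.smooth f).contDiffAt_comp_chart_symm x).of_le
      (m := r) (mod_cast le_top)
    have hg := ((SmoothFun.smooth g).contDiffAt_comp_chart_symm x).of_le
      (m := r) (mod_cast le_top)
    have h := fun_iteratedFDeriv_add_apply hf hg
    exact congrArg (fun A => A v) h
  map_smul' c f := by
    rw [RingHom.id_apply, smul_eq_mul, ← contraction_mul_left]
    congr 1
    funext v
    have hf := ((SmoothFun.smooth f).contDiffAt_comp_chart_symm x).of_le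
      (m := r) (mod_cast le_top)
    have h := iteratedFDeriv_const_smul_apply (𝕜 := ℝ) (a := c) hf
    exact congrArg (fun A => A v) h

theorem contractDiff_eq_zero {x : M} {r : ℕ}
    (S : MultilinearMap ℝ (fun _ : Fin r => Module.Dual ℝ (TangentSpace 𝓘(ℝ, E) x)) ℂ)
    {f : SmoothFun E M} (hf : f ∈ (vanishingIdeal x : Ideal (SmoothFun E M)) ^ (r + 1)) :
    contractDiff S f = 0 := by
  have h : iteratedDiffAt (E := E) (f : M → ℂ) r x = fun _ => 0 * (0 : ℂ) := by
    funext v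
    have := congrArg (fun A => A v) (vanishesTo_of_mem_pow hf r (Nat.lt_succ_self r))
    exact this.trans (zero_mul (0 : ℂ)).symm
  change contraction S (iteratedDiffAt (E := E) (f : M → ℂ) r x) = 0
  rw [h, contraction_mul_left, zero_mul]

theorem iteratedDiffAt_prod_covectorFun {x : M} {r : ℕ}
    (α : Fin r → Module.Dual ℝ (TangentSpace 𝓘(ℝ, E) x))
    (v : Fin r → TangentSpace 𝓘(ℝ, E) x) :
    iteratedDiffAt ((∏ i, covectorFun x (α i) : SmoothFun E M) : M → ℂ) r x v =
      ∑ s : Equiv.Perm (Fin r), ∏ i, ((α i (v (s i)) : ℝ) : ℂ) := by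
  let a : Fin r → E →L[ℝ] ℂ := fun i =>
    Complex.ofRealCLM.comp (LinearMap.toContinuousLinearMap (𝕜 := ℝ) (E := E) (F' := ℝ) (α i))
  have h : ((∏ i, covectorFun x (α i) : SmoothFun E M) : M → ℂ) ∘ (chartAt E x).symm
      =ᶠ[nhds (chartAt E x x)] fun y => ∏ i, a i (y - chartAt E x x : E) := by
    have h1 : ∀ i, (covectorFun x (α i) : M → ℂ) ∘ (chartAt E x).symm
        =ᶠ[nhds (chartAt E x x)] fun y => a i (y - chartAt E x x) := fun i =>
      by
      exact chartCutoff_comp_chart_symm x (fun y : E => a i (y - chartAt E x x))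
    filter_upwards [Filter.eventually_all.2 h1] with y hy
    rw [Function.comp_apply, SmoothFun.prod_apply]
    exact Finset.prod_congr rfl fun i _ => hy i
  have h2 := (h.iteratedFDeriv ℝ r).self_of_nhds
  exact (congrArg (fun A => A v) h2).trans (iteratedFDeriv_prod_linear a _ v)

/-- Each of the `r!` permutations contributes the same value, by symmetry of `S`. This recovers a
symmetric tensor from its contractions with differentials, and fixes the factor `1 / r!` in
`symbolAt`. -/
theorem contractDiff_prod_covectorFun {x : M} {r : ℕ}
    {S : MultilinearMap ℝ (fun _ : Fin r => Module.Dual ℝ (TangentSpace 𝓘(ℝ, E) x)) ℂ}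
    (hS : ∀ (s : Equiv.Perm (Fin r)) (α : Fin r → Module.Dual ℝ (TangentSpace 𝓘(ℝ, E) x)),
      S (fun i => α (s i)) = S α)
    (α : Fin r → Module.Dual ℝ (TangentSpace 𝓘(ℝ, E) x)) :
    contractDiff S (∏ i, covectorFun x (α i)) = (r.factorial : ℂ) * S α := by
  have h : iteratedDiffAt ((∏ i, covectorFun x (α i) : SmoothFun E M) : M → ℂ) r x =
      fun v => ∑ s : Equiv.Perm (Fin r), ∏ i, ((α (s i) (v i) : ℝ) : ℂ) := by
    funext v
    refine (iteratedDiffAt_prod_covectorFun α v).trans ?_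
    -- Passing to inverse permutations moves them from the vectors to the covectors, where the
    -- symmetry of `S` applies.
    rw [← Equiv.sum_comp (Equiv.inv (Equiv.Perm (Fin r)))]
    refine Finset.sum_congr rfl fun s _ => ?_
    rw [← Equiv.prod_comp s]
    simp
  change contraction S (iteratedDiffAt _ r x) = _
  rw [h, contraction_sum, Finset.sum_congr rfl fun s _ =>
    (contraction_prod S (fun i => α (s i))).trans (hS s α)]
  simp [Fintype.card_perm]

theorem covectorFun_mem (x : M) (α : Module.Dual ℝ (TangentSpace 𝓘(ℝ, E) x)) :
    covectorFun x α ∈ vanishingIdeal x :=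
  coordFun_mem (E := E) x α

theorem prod_covectorFun_mem {x : M} {r : ℕ}
    (α : Fin r → Module.Dual ℝ (TangentSpace 𝓘(ℝ, E) x)) :
    ∏ i, covectorFun x (α i) ∈ (vanishingIdeal x : Ideal (SmoothFun E M)) ^ r := by
  have := Ideal.prod_mem_prod (I := fun _ : Fin r => (vanishingIdeal x : Ideal (SmoothFun E M)))
    (s := Finset.univ) fun i _ => covectorFun_mem x (α i)
  simpa using this

/-- Two tensors which contract in the same way with differentials of order `r` are equal. -/
theorem HasSymbol.unique {r : ℕ} {P : Module.End ℂ (SmoothFun E M)} {S T : SymTensorField E M r}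
    (hS : HasSymbol r P S) (hT : HasSymbol r P T) : S = T := by
  apply Subtype.ext
  funext x
  ext α
  have h := (hS.2 x _ (prod_covectorFun_mem α)).symm.trans (hT.2 x _ (prod_covectorFun_mem α))
  have h1 := (contractDiff_prod_covectorFun (S.2.1 x) α).symm.trans
    (h.trans (contractDiff_prod_covectorFun (T.2.1 x) α))
  exact mul_left_cancel₀ (mod_cast r.factorial_ne_zero) h1

end Symbols

/-! ### Existence of symbols -/

/-- Telescoping: exchanging one factor costs an element of `I ^ 2` times the remaining `s.card - 1`
factors, all in `I`. -/
theorem Ideal.prod_sub_prod_mem_pow {R ι : Type*} [CommRing R] {I : Ideal R} (s : Finset ι)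
    {u w : ι → R} (hu : ∀ i, u i ∈ I) (hw : ∀ i, w i ∈ I) (huw : ∀ i, u i - w i ∈ I ^ 2) :
    ∏ i ∈ s, u i - ∏ i ∈ s, w i ∈ I ^ (s.card + 1) := by
  classical
  induction s using Finset.induction_on with
  | empty => simp
  | insert a s ha ih =>
    rw [Finset.prod_insert ha, Finset.prod_insert ha, Finset.card_insert_of_notMem ha]
    have h : u a * ∏ i ∈ s, u i - w a * ∏ i ∈ s, w i =
        (u a - w a) * ∏ i ∈ s, u i + w a * (∏ i ∈ s, u i - ∏ i ∈ s, w i) := by ring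
    have hp : ∏ i ∈ s, u i ∈ I ^ s.card := by
      simpa using Ideal.prod_mem_prod (I := fun _ : ι => I) (s := s) fun i _ => hu i
    rw [h]
    refine Ideal.add_mem _ ?_ ?_
    · rw [show s.card + 1 + 1 = 2 + s.card by ring, pow_add]
      exact Ideal.mul_mem_mul (huw a) hp
    · rw [pow_succ' I (s.card + 1)]
      exact Ideal.mul_mem_mul (hw a) ih

section Symbols

variable {E : Type*} [NormedAddCommGroup E] [NormedSpace ℝ E]
  {M : Type*} [TopologicalSpace M] [ChartedSpace E M]

/-- A real smooth function as a complex smooth function. -/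
def SmoothFun.ofReal (f : M → ℝ) (hf : ContMDiff 𝓘(ℝ, E) 𝓘(ℝ, ℝ) ∞ f) : SmoothFun E M :=
  ⟨fun y => (f y : ℂ), Complex.ofRealCLM.contDiff.contMDiff.comp hf⟩

variable [IsManifold 𝓘(ℝ, E) ∞ M]

theorem mvfderiv_eq_fderiv {F : Type*} [NormedAddCommGroup F] [NormedSpace ℝ F] {f : M → F}
    (hf : ContMDiff 𝓘(ℝ, E) 𝓘(ℝ, F) ∞ f) (x : M) (v : E) :
    mvfderiv 𝓘(ℝ, E) f x v = fderiv ℝ (f ∘ (chartAt E x).symm) (chartAt E x x) v := by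
  have hd : MDifferentiableAt 𝓘(ℝ, E) 𝓘(ℝ, F) f x := (hf x).mdifferentiableAt (by simp)
  have h : mfderiv 𝓘(ℝ, E) 𝓘(ℝ, F) f x v =
      fderiv ℝ (f ∘ (chartAt E x).symm) (chartAt E x x) v := by
    rw [hd.mfderiv]
    simp [writtenInExtChartAt, Function.comp_def]
    rfl
  exact h

variable [FiniteDimensional ℝ E] [T2Space M]

/-- This is Hadamard's lemma for `f - f(x)`, its linear part reassembled by linearity of `coordFun`
in the covector. It links the coordinate functions defining the symbol to the differentials that
test smoothness of a tensor field. -/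
theorem sub_covectorFun_mem_sq {f : M → ℝ} (hf : ContMDiff 𝓘(ℝ, E) 𝓘(ℝ, ℝ) ∞ f) (x : M) :
    SmoothFun.ofReal f hf - algebraMap ℂ (SmoothFun E M) (f x : ℂ) -
      covectorFun x (mvfderiv 𝓘(ℝ, E) f x).toLinearMap ∈
        (vanishingIdeal x : Ideal (SmoothFun E M)) ^ 2 := by
  have h := sub_sum_coordFun_mem_sq (SmoothFun.sub_eval_mem (SmoothFun.ofReal f hf) x)
  set b := Module.finBasis ℝ E
  let α : Module.Dual ℝ E := (mvfderiv 𝓘(ℝ, E) f x).toLinearMap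
  have hα : ∀ v : E, fderiv ℝ (((SmoothFun.ofReal f hf -
      algebraMap ℂ (SmoothFun E M) ((SmoothFun.ofReal f hf : M → ℂ) x) : SmoothFun E M) : M → ℂ) ∘
        (chartAt E x).symm) (chartAt E x x) v = ((α v : ℝ) : ℂ) := by
    intro v
    have hd : HasFDerivAt (f ∘ (chartAt E x).symm)
        (fderiv ℝ (f ∘ (chartAt E x).symm) (chartAt E x x)) (chartAt E x x) :=
      ((hf.contDiffAt_comp_chart_symm x).differentiableAt (by simp)).hasFDerivAt
    have h1 := (Complex.ofRealCLM.hasFDerivAt.comp (chartAt E x x) hd).sub_const (f x : ℂ)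
    refine (congrArg (fun A => A v) h1.fderiv).trans ?_
    change ((fderiv ℝ (f ∘ (chartAt E x).symm) (chartAt E x x) v : ℝ) : ℂ) = _
    rw [← mvfderiv_eq_fderiv hf]
    rfl
  have hsum : ∑ j, fderiv ℝ (((SmoothFun.ofReal f hf -
      algebraMap ℂ (SmoothFun E M) ((SmoothFun.ofReal f hf : M → ℂ) x) : SmoothFun E M) : M → ℂ) ∘
        (chartAt E x).symm) (chartAt E x x) (b j) • coordFun x (b.coord j) =
      coordFun (M := M) x α := by
    conv_rhs => rw [← b.sum_dual_apply_smul_coord α, map_sum]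
    refine Finset.sum_congr rfl fun j _ => ?_
    rw [hα, map_smul]
    ext y
    exact (Complex.real_smul).symm
  rw [hsum] at h
  exact h

/-- The multilinear map underlying the symbol of order `r` at a point. -/
def symbolAt (r : ℕ) (P : Module.End ℂ (SmoothFun E M)) (x : M) :
    MultilinearMap ℝ (fun _ : Fin r => Module.Dual ℝ (TangentSpace 𝓘(ℝ, E) x)) ℂ :=
  (((r.factorial : ℂ)⁻¹ • (SmoothFun.eval x ∘ₗ P)).restrictScalars ℝ).compMultilinearMap
    ((MultilinearMap.mkPiAlgebra ℝ (Fin r) (SmoothFun E M)).compLinearMap fun _ => covectorFun x)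

theorem symbolAt_apply (r : ℕ) (P : Module.End ℂ (SmoothFun E M)) (x : M)
    (α : Fin r → Module.Dual ℝ (TangentSpace 𝓘(ℝ, E) x)) :
    symbolAt r P x α =
      (r.factorial : ℂ)⁻¹ * (P (∏ i, covectorFun x (α i)) : M → ℂ) x := rfl

theorem symbolAt_symm (r : ℕ) (P : Module.End ℂ (SmoothFun E M)) (x : M)
    (s : Equiv.Perm (Fin r)) (α : Fin r → Module.Dual ℝ (TangentSpace 𝓘(ℝ, E) x)) :
    symbolAt r P x (fun i => α (s i)) = symbolAt r P x α := by
  rw [symbolAt_apply, symbolAt_apply, Equiv.prod_comp s fun i => covectorFun x (α i)]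

theorem IsDiffOpOfOrder.apply_eq {r : ℕ} {P : Module.End ℂ (SmoothFun E M)}
    (hP : IsDiffOpOfOrder r P) {x : M} {f g : SmoothFun E M}
    (h : f - g ∈ (vanishingIdeal x : Ideal (SmoothFun E M)) ^ (r + 1)) :
    (P f : M → ℂ) x = (P g : M → ℂ) x := by
  have h1 := hP x _ h
  rw [map_sub] at h1
  exact sub_eq_zero.1 h1

/-- The value of `P` on a product of functions translated by their values at the point is a smooth
function of the point. -/
theorem exists_smooth_apply_prod_sub (P : Module.End ℂ (SmoothFun E M)) {ι : Type*} [Fintype ι]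
    (f : ι → SmoothFun E M) : ∃ g : SmoothFun E M, ∀ x,
      (P (∏ i, (f i - algebraMap ℂ (SmoothFun E M) ((f i : M → ℂ) x))) : M → ℂ) x =
        (g : M → ℂ) x := by
  classical
  -- Expand the product over subsets. The numbers `-f_i(x)` leave `P` by linearity and, as `x`
  -- varies, become the smooth functions `-f_i`.
  refine ⟨∑ t ∈ (Finset.univ : Finset ι).powerset,
    (∏ i ∈ Finset.univ \ t, -f i) * P (∏ i ∈ t, f i), fun x => ?_⟩
  have h : ∏ i, (f i - algebraMap ℂ (SmoothFun E M) ((f i : M → ℂ) x)) =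
      ∑ t ∈ (Finset.univ : Finset ι).powerset,
        (∏ i ∈ Finset.univ \ t, -((f i : M → ℂ) x)) • ∏ i ∈ t, f i := by
    simp only [sub_eq_add_neg, Finset.prod_add]
    refine Finset.sum_congr rfl fun t _ => ?_
    rw [Algebra.smul_def, mul_comm, map_prod]
    simp
  rw [h, map_sum, SmoothFun.sum_apply, SmoothFun.sum_apply]
  refine Finset.sum_congr rfl fun t _ => ?_
  rw [map_smul]
  change (∏ i ∈ Finset.univ \ t, -((f i : M → ℂ) x)) * _ =
    ((∏ i ∈ Finset.univ \ t, -f i : SmoothFun E M) : M → ℂ) x * _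
  rw [SmoothFun.prod_apply]
  rfl

/-- The coordinate functions in `symbolAt` depend on `x` through the chosen chart and cutoff, so
smoothness in `x` is not visible. Modulo `m_x ^ (r + 1)`, which `P` does not see at `x`, they may be
replaced by `f_i - f_i(x)`, where `exists_smooth_apply_prod_sub` applies. -/
theorem symbolAt_mem {r : ℕ} {P : Module.End ℂ (SmoothFun E M)} (hP : IsDiffOpOfOrder r P) :
    symbolAt r P ∈ SymTensorField E M r := by
  refine ⟨symbolAt_symm r P, fun f hf => ?_⟩
  obtain ⟨g, hg⟩ := exists_smooth_apply_prod_sub P fun i => SmoothFun.ofReal (f i) (hf i)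
  have h : (fun x => symbolAt r P x fun i => (mvfderiv 𝓘(ℝ, E) (f i) x).toLinearMap) =
      (((r.factorial : ℂ)⁻¹ • g : SmoothFun E M) : M → ℂ) := by
    funext x
    rw [symbolAt_apply]
    change _ = (r.factorial : ℂ)⁻¹ * (g : M → ℂ) x
    rw [← hg x]
    congr 1
    symm
    apply hP.apply_eq
    have := Ideal.prod_sub_prod_mem_pow (I := (vanishingIdeal x : Ideal (SmoothFun E M)))
      (Finset.univ : Finset (Fin r))
      (fun i => SmoothFun.sub_eval_mem (SmoothFun.ofReal (f i) (hf i)) x)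
      (fun i => covectorFun_mem x (mvfderiv 𝓘(ℝ, E) (f i) x).toLinearMap)
      (fun i => sub_covectorFun_mem_sq (hf i) x)
    simpa using this
  rw [h]
  exact SmoothFun.smooth _

/-- The symbol of order `r` of an operator of order `r`. -/
def IsDiffOpOfOrder.symbol {r : ℕ} {P : Module.End ℂ (SmoothFun E M)} (hP : IsDiffOpOfOrder r P) :
    SymTensorField E M r :=
  ⟨symbolAt r P, symbolAt_mem hP⟩

/-- The two sides differ by a functional that kills `m_x ^ (r + 1)` and all `r`-fold products of
coordinate functions, the factor `r!` cancelling the normalization; `eq_zero_of_mem_pow` concludes.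
-/
theorem IsDiffOpOfOrder.hasSymbol {r : ℕ} {P : Module.End ℂ (SmoothFun E M)}
    (hP : IsDiffOpOfOrder r P) : HasSymbol r P hP.symbol := by
  refine ⟨hP, fun x f hf => ?_⟩
  let L := (SmoothFun.eval x ∘ₗ P) - contractDiff (symbolAt r P x)
  have hpow : ∀ g ∈ (vanishingIdeal x : Ideal (SmoothFun E M)) ^ (r + 1), L g = 0 := fun g hg => by
    rw [LinearMap.sub_apply, contractDiff_eq_zero _ hg, sub_zero]
    exact hP x g hg
  have hprod : ∀ α : Fin r → Module.Dual ℝ (TangentSpace 𝓘(ℝ, E) x),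
      L (∏ i, covectorFun x (α i)) = 0 := fun α => by
    have h := contractDiff_prod_covectorFun (symbolAt_symm r P x) α
    rw [symbolAt_apply, ← mul_assoc, mul_inv_cancel₀ (mod_cast r.factorial_ne_zero), one_mul] at h
    exact sub_eq_zero.2 h.symm
  exact sub_eq_zero.1 (eq_zero_of_mem_pow L hpow hprod hf)

/-- An operator whose symbol of order `r + 1` is zero has order `r`. -/
theorem HasSymbol.isDiffOpOfOrder_of_zero {r : ℕ} {P : Module.End ℂ (SmoothFun E M)}
    (h : HasSymbol (r + 1) P 0) : IsDiffOpOfOrder r P := by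
  intro x f hf
  refine (h.2 x f hf).trans ?_
  simp [contraction]

/-- The zeroth power of the ideal is the whole ring, so the symbol of order `0` determines `P f` for
every `f`. This ends the descent. -/
theorem HasSymbol.eq_zero_of_zero {P : Module.End ℂ (SmoothFun E M)}
    (h : HasSymbol 0 P 0) : P = 0 := by
  ext f x
  refine (h.2 x f (by simp)).trans ?_
  simp [contraction]

theorem HasSymbol.add {r : ℕ} {P Q : Module.End ℂ (SmoothFun E M)} {S T : SymTensorField E M r}
    (hS : HasSymbol r P S) (hT : HasSymbol r Q T) : HasSymbol r (P + Q) (S + T) := by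
  refine ⟨fun x f hf => Ideal.add_mem _ (hS.1 x f hf) (hT.1 x f hf), fun x f hf => ?_⟩
  refine (congrArg₂ (· + ·) (hS.2 x f hf) (hT.2 x f hf)).trans ?_
  exact (add_contraction _ _ _).symm

/-- Since `s + 1 ≤ r`, the operator already sends `m_x ^ r` into `m_x`. Terms of lower order are
therefore invisible to the top symbol. -/
theorem IsDiffOpOfOrder.hasSymbol_zero {r s : ℕ} {P : Module.End ℂ (SmoothFun E M)}
    (hP : IsDiffOpOfOrder s P) (hsr : s < r) : HasSymbol r P 0 := by
  refine ⟨hP.mono hsr.le, fun x f hf => ?_⟩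
  refine (hP x f (Ideal.pow_le_pow_right hsr hf)).trans ?_
  simp [contraction]

end Symbols

/-! ### Vector fields in a chart -/

section VectorFields

variable {E : Type*} [NormedAddCommGroup E] [NormedSpace ℝ E]
  {M : Type*} [TopologicalSpace M] [ChartedSpace E M] [IsManifold 𝓘(ℝ, E) ∞ M]

/-- Coordinates of tangent vectors in the chart at `x₀`. -/
def tangentCoord (x₀ x : M) : TangentSpace 𝓘(ℝ, E) x →L[ℝ] E :=
  (trivializationAt E (TangentSpace 𝓘(ℝ, E)) x₀).continuousLinearMapAt ℝ x

/-- The tangent vectors with given coordinates in the chart at `x₀`. -/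
def tangentFrame (x₀ x : M) : E →L[ℝ] TangentSpace 𝓘(ℝ, E) x :=
  (trivializationAt E (TangentSpace 𝓘(ℝ, E)) x₀).symmL ℝ x

theorem tangentFrame_coord {x₀ x : M} (hx : x ∈ (chartAt E x₀).source)
    (v : TangentSpace 𝓘(ℝ, E) x) : tangentFrame x₀ x (tangentCoord x₀ x v) = v :=
  (trivializationAt E (TangentSpace 𝓘(ℝ, E)) x₀).symmL_continuousLinearMapAt hx v

theorem tangentCoord_frame {x₀ x : M} (hx : x ∈ (chartAt E x₀).source) (v : E) :
    tangentCoord x₀ x (tangentFrame x₀ x v) = v :=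
  (trivializationAt E (TangentSpace 𝓘(ℝ, E)) x₀).continuousLinearMapAt_symmL hx v

theorem tangentCoord_self (x : M) (v : TangentSpace 𝓘(ℝ, E) x) : tangentCoord x x v = v := by
  rw [tangentCoord, TangentBundle.continuousLinearMapAt_trivializationAt (mem_chart_source E x),
    mfderiv_extChartAt_self]
  rfl

/-- A vector field, read in the chart at `x₀`. -/
def chartRep (x₀ : M) (X : ∀ x : M, TangentSpace 𝓘(ℝ, E) x) (y : E) : E :=
  tangentCoord x₀ ((chartAt E x₀).symm y) (X ((chartAt E x₀).symm y))

theorem chartRep_apply {x₀ x : M} (hx : x ∈ (chartAt E x₀).source)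
    (X : ∀ x : M, TangentSpace 𝓘(ℝ, E) x) :
    chartRep x₀ X (chartAt E x₀ x) = tangentCoord x₀ x (X x) := by
  rw [chartRep, (chartAt E x₀).left_inv hx]

section

variable {F : Type*} [NormedAddCommGroup F] [NormedSpace ℝ F] {n : ℕ∞ω}

theorem contMDiffAt_iff_comp_chart_symm (hn : n ≤ ∞) {x₀ x : M} (hx : x ∈ (chartAt E x₀).source)
    {g : M → F} : ContMDiffAt 𝓘(ℝ, E) 𝓘(ℝ, F) n g x ↔
      ContDiffAt ℝ n (g ∘ (chartAt E x₀).symm) (chartAt E x₀ x) := by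
  constructor
  · intro h
    rw [← contMDiffAt_iff_contDiffAt]
    have h1 : ContMDiffAt 𝓘(ℝ, E) 𝓘(ℝ, E) n (chartAt E x₀).symm (chartAt E x₀ x) :=
      ((contMDiffOn_chart_symm' x₀).contMDiffAt
        ((chartAt E x₀).open_target.mem_nhds ((chartAt E x₀).map_source hx))).of_le hn
    exact ContMDiffAt.comp _ (by rwa [(chartAt E x₀).left_inv hx]) h1
  · intro h
    have h1 : ContMDiffAt 𝓘(ℝ, E) 𝓘(ℝ, E) n (chartAt E x₀) x :=
      ((contMDiffOn_chart (I := 𝓘(ℝ, E)) (n := ∞) (x := x₀)).contMDiffAt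
        ((chartAt E x₀).open_source.mem_nhds hx)).of_le hn
    refine (h.contMDiffAt.comp x h1).congr_of_eventuallyEq ?_
    filter_upwards [(chartAt E x₀).open_source.mem_nhds hx] with y hy
    simp [(chartAt E x₀).left_inv hy]

theorem mdifferentiableAt_iff_comp_chart_symm {x₀ x : M} (hx : x ∈ (chartAt E x₀).source)
    {g : M → F} : MDifferentiableAt 𝓘(ℝ, E) 𝓘(ℝ, F) g x ↔
      DifferentiableAt ℝ (g ∘ (chartAt E x₀).symm) (chartAt E x₀ x) := by
  constructor
  · intro h
    rw [← mdifferentiableAt_iff_differentiableAt]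
    have h1 : MDifferentiableAt 𝓘(ℝ, E) 𝓘(ℝ, E) (chartAt E x₀).symm (chartAt E x₀ x) :=
      ((contMDiffOn_chart_symm' x₀).contMDiffAt
        ((chartAt E x₀).open_target.mem_nhds
          ((chartAt E x₀).map_source hx))).mdifferentiableAt (by simp)
    exact MDifferentiableAt.comp _ (by rwa [(chartAt E x₀).left_inv hx]) h1
  · intro h
    have h1 : MDifferentiableAt 𝓘(ℝ, E) 𝓘(ℝ, E) (chartAt E x₀) x :=
      ((contMDiffOn_chart (I := 𝓘(ℝ, E)) (n := ∞) (x := x₀)).contMDiffAt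
        ((chartAt E x₀).open_source.mem_nhds hx)).mdifferentiableAt (by simp)
    refine (h.mdifferentiableAt.comp x h1).congr_of_eventuallyEq ?_
    filter_upwards [(chartAt E x₀).open_source.mem_nhds hx] with y hy
    simp [(chartAt E x₀).left_inv hy]

/-- The differential of a function, in terms of its expression in the chart at `x₀`. -/
theorem mvfderiv_eq_fderiv_comp_chart_symm {x₀ x : M} (hx : x ∈ (chartAt E x₀).source)
    {g : M → F} (hg : MDifferentiableAt 𝓘(ℝ, E) 𝓘(ℝ, F) g x) (v : TangentSpace 𝓘(ℝ, E) x) :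
    mvfderiv 𝓘(ℝ, E) g x v =
      fderiv ℝ (g ∘ (chartAt E x₀).symm) (chartAt E x₀ x) (tangentCoord x₀ x v) := by
  have h1 : MDifferentiableAt 𝓘(ℝ, E) 𝓘(ℝ, E) (extChartAt 𝓘(ℝ, E) x₀) x :=
    mdifferentiableAt_extChartAt hx
  have h2 : DifferentiableAt ℝ (g ∘ (chartAt E x₀).symm) (chartAt E x₀ x) :=
    (mdifferentiableAt_iff_comp_chart_symm hx).1 hg
  have h3 : HasMFDerivAt 𝓘(ℝ, E) 𝓘(ℝ, F) (g ∘ (chartAt E x₀).symm) (extChartAt 𝓘(ℝ, E) x₀ x)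
      (fderiv ℝ (g ∘ (chartAt E x₀).symm) (chartAt E x₀ x)) := by
    have : extChartAt 𝓘(ℝ, E) x₀ x = chartAt E x₀ x := by simp
    rw [this]
    exact h2.hasFDerivAt.hasMFDerivAt
  have h4 := h3.comp x h1.hasMFDerivAt
  have h5 : g =ᶠ[nhds x] (g ∘ (chartAt E x₀).symm) ∘ extChartAt 𝓘(ℝ, E) x₀ := by
    filter_upwards [(chartAt E x₀).open_source.mem_nhds hx] with y hy
    simp [(chartAt E x₀).left_inv hy]
  have h6 := (h4.congr_of_eventuallyEq h5).mfderiv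
  rw [tangentCoord, TangentBundle.continuousLinearMapAt_trivializationAt hx]
  change mfderiv 𝓘(ℝ, E) 𝓘(ℝ, F) g x v = _
  rw [h6]
  rfl

end

theorem trivialization_snd_eventuallyEq {x₀ x : M} (hx : x ∈ (chartAt E x₀).source)
    (X : ∀ x : M, TangentSpace 𝓘(ℝ, E) x) :
    (fun y => (trivializationAt E (TangentSpace 𝓘(ℝ, E)) x₀ ⟨y, X y⟩).2) ∘ (chartAt E x₀).symm
      =ᶠ[nhds (chartAt E x₀ x)] chartRep x₀ X := by
  filter_upwards [(chartAt E x₀).open_target.mem_nhds ((chartAt E x₀).map_source hx)] with y hy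
  have hy' : (chartAt E x₀).symm y ∈ (trivializationAt E (TangentSpace 𝓘(ℝ, E)) x₀).baseSet :=
    (chartAt E x₀).map_target hy
  exact (Bundle.Trivialization.continuousLinearMapAt_apply_of_mem (R := ℝ) _ hy' _).symm

theorem contMDiffAt_section_iff_chartRep {n : ℕ∞ω} (hn : n ≤ ∞) {x₀ x : M}
    (hx : x ∈ (chartAt E x₀).source) {X : ∀ x : M, TangentSpace 𝓘(ℝ, E) x} :
    ContMDiffAt 𝓘(ℝ, E) (𝓘(ℝ, E).prod 𝓘(ℝ, E)) n
        (fun y => Bundle.TotalSpace.mk' E y (X y)) x ↔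
      ContDiffAt ℝ n (chartRep x₀ X) (chartAt E x₀ x) := by
  have : ContMDiffVectorBundle n E (TangentSpace 𝓘(ℝ, E) : M → Type _) 𝓘(ℝ, E) :=
    ContMDiffVectorBundle.of_le hn
  rw [(trivializationAt E (TangentSpace 𝓘(ℝ, E)) x₀).contMDiffAt_section_iff hx,
    contMDiffAt_iff_comp_chart_symm hn hx]
  exact ⟨fun h => h.congr_of_eventuallyEq (trivialization_snd_eventuallyEq hx X).symm,
    fun h => h.congr_of_eventuallyEq (trivialization_snd_eventuallyEq hx X)⟩

theorem mdifferentiableAt_section_iff_chartRep {x₀ x : M}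
    (hx : x ∈ (chartAt E x₀).source) {X : ∀ x : M, TangentSpace 𝓘(ℝ, E) x} :
    MDifferentiableAt 𝓘(ℝ, E) (𝓘(ℝ, E).prod 𝓘(ℝ, E))
        (fun y => Bundle.TotalSpace.mk' E y (X y)) x ↔
      DifferentiableAt ℝ (chartRep x₀ X) (chartAt E x₀ x) := by
  rw [(trivializationAt E (TangentSpace 𝓘(ℝ, E)) x₀).mdifferentiableAt_section_iff 𝓘(ℝ, E) X hx,
    mdifferentiableAt_iff_comp_chart_symm hx]
  exact (trivialization_snd_eventuallyEq hx X).differentiableAt_iff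

theorem chartRep_tangentFrame (x₀ : M) (v : E) :
    Set.EqOn (chartRep x₀ fun x => tangentFrame x₀ x v) (fun _ => v) (chartAt E x₀).target :=
  fun _ hy => tangentCoord_frame ((chartAt E x₀).map_target hy) v

theorem contMDiffAt_tangentFrame {x₀ x : M} (hx : x ∈ (chartAt E x₀).source) (v : E) :
    ContMDiffAt 𝓘(ℝ, E) (𝓘(ℝ, E).prod 𝓘(ℝ, E)) ∞
      (fun y => Bundle.TotalSpace.mk' E y (tangentFrame x₀ y v)) x := by
  refine (contMDiffAt_section_iff_chartRep le_rfl hx).2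
    ((contDiffAt_const (c := v)).congr_of_eventuallyEq ?_)
  filter_upwards [(chartAt E x₀).open_target.mem_nhds ((chartAt E x₀).map_source hx)] with y hy
  exact chartRep_tangentFrame x₀ v hy

end VectorFields

/-! ### Christoffel symbols -/

section Christoffel

variable {E : Type*} [NormedAddCommGroup E] [NormedSpace ℝ E] [FiniteDimensional ℝ E]
  {M : Type*} [TopologicalSpace M] [ChartedSpace E M] [IsManifold 𝓘(ℝ, E) ∞ M]
  (cov : CovariantDerivative 𝓘(ℝ, E) E (TangentSpace 𝓘(ℝ, E) : M → Type _))

/-- The covariant derivative of the coordinate field `v`, in the chart at `x₀`. -/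
def covFrame (x₀ : M) (v : E) (y : E) : E →L[ℝ] E :=
  (tangentCoord x₀ ((chartAt E x₀).symm y)).comp
    ((cov (fun x => tangentFrame x₀ x v) ((chartAt E x₀).symm y)).comp
      (tangentFrame x₀ ((chartAt E x₀).symm y)))

/-- The Christoffel symbols in the chart at `x₀`. The first argument is the direction of
differentiation. -/
def christoffel (x₀ : M) (y : E) : E →L[ℝ] E →L[ℝ] E :=
  ∑ j, (ContinuousLinearMap.smulRightL ℝ E E
    (LinearMap.toContinuousLinearMap ((Module.finBasis ℝ E).coord j))).comp
      (covFrame cov x₀ (Module.finBasis ℝ E j) y)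

theorem christoffel_apply (x₀ : M) (y w v : E) :
    christoffel cov x₀ y w v = ∑ j, (Module.finBasis ℝ E).coord j v •
      covFrame cov x₀ (Module.finBasis ℝ E j) y w := by
  simp [christoffel]

/-- The connection minus the flat derivative of the chart is tensorial in `X`, because the
derivative terms of the two Leibniz rules cancel. It is thus determined by the value of `X` at `x`,
and on coordinate fields, whose flat derivative is zero, it gives the Christoffel symbols. -/
theorem tangentCoord_cov {x₀ x : M} (hx : x ∈ (chartAt E x₀).source)
    {X : ∀ x : M, TangentSpace 𝓘(ℝ, E) x}
    (hX : DifferentiableAt ℝ (chartRep x₀ X) (chartAt E x₀ x)) (w : TangentSpace 𝓘(ℝ, E) x) :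
    tangentCoord x₀ x (cov X x w) =
      fderiv ℝ (chartRep x₀ X) (chartAt E x₀ x) (tangentCoord x₀ x w) +
        christoffel cov x₀ (chartAt E x₀ x) (tangentCoord x₀ x w)
          (chartRep x₀ X (chartAt E x₀ x)) := by
  let Φ : (∀ x : M, TangentSpace 𝓘(ℝ, E) x) → E := fun X =>
    tangentCoord x₀ x (cov X x w) -
      fderiv ℝ (chartRep x₀ X) (chartAt E x₀ x) (tangentCoord x₀ x w)
  have hΦ : TensorialAt 𝓘(ℝ, E) E Φ x := by
    constructor
    · intro f σ hf hσ
      have hσ' := (mdifferentiableAt_section_iff_chartRep hx).1 hσ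
      have hf' := (mdifferentiableAt_iff_comp_chart_symm hx).1 hf
      have hrep : chartRep x₀ (f • σ) =
          (f ∘ (chartAt E x₀).symm) • chartRep x₀ σ := by
        funext y
        simp [chartRep]
      have hfd := (hf'.hasFDerivAt.smul hσ'.hasFDerivAt).fderiv
      simp only [Φ]
      rw [cov.isCovariantDerivativeOnUniv.leibniz hσ hf, hrep, hfd]
      have h1 := mvfderiv_eq_fderiv_comp_chart_symm hx hf w
      simp only [_root_.add_apply, _root_.smul_apply, ContinuousLinearMap.smulRight_apply,
        map_add, map_smul, h1, Function.comp_apply, (chartAt E x₀).left_inv hx, smul_sub,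
        chartRep_apply hx]
      abel
    · intro σ τ hσ hτ
      have hσ' := (mdifferentiableAt_section_iff_chartRep hx).1 hσ
      have hτ' := (mdifferentiableAt_section_iff_chartRep hx).1 hτ
      have hrep : chartRep x₀ (σ + τ) = fun y => chartRep x₀ σ y + chartRep x₀ τ y := by
        funext y
        simp [chartRep]
      simp only [Φ]
      rw [cov.isCovariantDerivativeOnUniv.add hσ hτ, hrep, fderiv_fun_add hσ' hτ']
      simp only [_root_.add_apply, map_add]
      abel
  have hframe : ∀ v : E, MDifferentiableAt 𝓘(ℝ, E) (𝓘(ℝ, E).prod 𝓘(ℝ, E))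
      (fun y => Bundle.TotalSpace.mk' E y (tangentFrame x₀ y v)) x := fun v =>
    (contMDiffAt_tangentFrame hx v).mdifferentiableAt (by simp)
  let H := TensorialAt.mkHom Φ x hΦ
  have hH : ∀ v : E, H (tangentFrame x₀ x v) =
      tangentCoord x₀ x (cov (fun x => tangentFrame x₀ x v) x w) := by
    intro v
    have h1 := TensorialAt.mkHom_apply hΦ (hframe v)
    refine h1.trans ?_
    have h2 : fderiv ℝ (chartRep x₀ fun x => tangentFrame x₀ x v) (chartAt E x₀ x) = 0 := by
      have : chartRep x₀ (fun x => tangentFrame x₀ x v) =ᶠ[nhds (chartAt E x₀ x)] fun _ => v := by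
        filter_upwards [(chartAt E x₀).open_target.mem_nhds ((chartAt E x₀).map_source hx)]
          with y hy using chartRep_tangentFrame x₀ v hy
      rw [this.fderiv_eq]
      simp
    change tangentCoord x₀ x (cov (fun x => tangentFrame x₀ x v) x w) -
      fderiv ℝ (chartRep x₀ fun x => tangentFrame x₀ x v) (chartAt E x₀ x)
        (tangentCoord x₀ x w) = _
    rw [h2]
    simp
  have hX' := TensorialAt.mkHom_apply hΦ ((mdifferentiableAt_section_iff_chartRep hx).2 hX)
  have hXx : X x = tangentFrame x₀ x (chartRep x₀ X (chartAt E x₀ x)) := by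
    rw [chartRep_apply hx, tangentFrame_coord hx]
  rw [← sub_eq_iff_eq_add']
  refine hX'.symm.trans ?_
  change H (X x) = _
  rw [hXx, christoffel_apply]
  conv_lhs => rw [← (Module.finBasis ℝ E).sum_repr (chartRep x₀ X (chartAt E x₀ x))]
  rw [map_sum, map_sum]
  refine Finset.sum_congr rfl fun j _ => ?_
  rw [map_smul, map_smul, hH, covFrame]
  simp only [ContinuousLinearMap.comp_apply]
  rw [(chartAt E x₀).left_inv hx, tangentFrame_coord hx]
  rfl

variable [T2Space M]

/-- Coordinate fields are smooth only over the chart, while the smoothness of the connection is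
applied to global fields. A bump equal to `1` near the point extends them, and locality of the
connection shows that nothing changes there. -/
theorem contDiffOn_covFrame (hsmooth : CovariantDerivative.ContMDiffCovariantDerivative cov ∞)
    (x₀ : M) (v : E) : ContDiffOn ℝ ∞ (covFrame cov x₀ v) (chartAt E x₀).target := by
  rw [contDiffOn_clm_apply]
  intro w y hy
  apply ContDiffAt.contDiffWithinAt
  set x := (chartAt E x₀).symm y with hxdef
  have hx : x ∈ (chartAt E x₀).source := (chartAt E x₀).map_target hy
  have hxy : chartAt E x₀ x = y := (chartAt E x₀).right_inv hy
  obtain ⟨χ, -, hχ⟩ := (SmoothBumpFunction.nhds_basis_tsupport (I := 𝓘(ℝ, E)) x).mem_iff.1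
    ((chartAt E x₀).open_source.mem_nhds hx)
  have hframe : ContMDiffOn 𝓘(ℝ, E) (𝓘(ℝ, E).prod 𝓘(ℝ, E)) ∞
      (fun y => Bundle.TotalSpace.mk' E y (tangentFrame x₀ y v)) (chartAt E x₀).source :=
    fun z hz => (contMDiffAt_tangentFrame hz v).contMDiffWithinAt
  have hglob := ContMDiffOn.smul_section_of_tsupport χ.contMDiff.contMDiffOn
    (chartAt E x₀).open_source hχ hframe
  have hcov := hsmooth.contMDiff.contMDiff (σ := (χ : M → ℝ) • fun y => tangentFrame x₀ y v)
    (by simpa using hglob.contMDiffOn)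
  have hcovx := (hcov.contMDiffAt Filter.univ_mem).clm_bundle_apply
    (contMDiffAt_tangentFrame hx w)
  have hrep := (contMDiffAt_section_iff_chartRep le_rfl hx).1 hcovx
  rw [hxy] at hrep
  refine hrep.congr_of_eventuallyEq ?_
  -- The two formulas must agree at every `z` near `x`, and locality at `z` needs `χ = 1` on a whole
  -- neighbourhood of `z`.
  have hone : ∀ᶠ z in nhds x, ∀ᶠ z' in nhds z, χ z' = 1 :=
    eventually_eventually_nhds.2 χ.eventuallyEq_one
  have htend : Filter.Tendsto (chartAt E x₀).symm (nhds y) (nhds x) :=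
    (chartAt E x₀).continuousAt_symm hy
  filter_upwards [htend.eventually hone, (chartAt E x₀).open_target.mem_nhds hy] with z hz hzt
  have hzs := (chartAt E x₀).map_target hzt
  have hloc := cov.isCovariantDerivativeOnUniv.congr_of_eventuallyEq
    ((hglob _).mdifferentiableAt (by simp))
    ((contMDiffAt_tangentFrame hzs v).mdifferentiableAt (by simp)) Filter.univ_mem
    (hz.mono fun z' hz' => by simp [hz'])
  simp only [covFrame, chartRep, ContinuousLinearMap.comp_apply]
  rw [hloc]

theorem contDiffOn_christoffel (hsmooth : CovariantDerivative.ContMDiffCovariantDerivative cov ∞)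
    (x₀ : M) : ContDiffOn ℝ ∞ (christoffel cov x₀) (chartAt E x₀).target := by
  refine ContDiffOn.sum fun j _ => ?_
  exact contDiffOn_const.clm_comp (contDiffOn_covFrame cov hsmooth x₀ _)

end Christoffel

/-! ### Iterated covariant differentials in a chart -/

section ChartTensor

set_option maxSynthPendingDepth 3

variable {E : Type*} [NormedAddCommGroup E] [NormedSpace ℝ E]

variable (E) in
/-- The operation `A ↦ ∑ i, A (…, Γ(v₀, v_i), …)` on multilinear maps. -/
def christoffelAction (r : ℕ) :
    (E [×r]→L[ℝ] ℂ) →L[ℝ] (E →L[ℝ] E →L[ℝ] E) →L[ℝ] (E →L[ℝ] (E [×r]→L[ℝ] ℂ)) :=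
  (ContinuousLinearMap.compL ℝ E (E →L[ℝ] E) (E [×r]→L[ℝ] ℂ)).comp
    (((ContinuousMultilinearMap.compContinuousLinearMapContinuousMultilinear ℝ
      (fun _ : Fin r => E) (fun _ : Fin r => E) ℂ).linearDeriv
        (fun _ => ContinuousLinearMap.id ℝ E)).comp
          (ContinuousLinearMap.pi fun _ => ContinuousLinearMap.id ℝ (E →L[ℝ] E))).flip

/-- The linear derivative of composition, taken at identity maps, alters one slot at a time.
Bundling the action as a continuous bilinear map makes smoothness and `VanishesTo.bilinear`
available. -/
theorem christoffelAction_apply {r : ℕ} (A : E [×r]→L[ℝ] ℂ) (Γ : E →L[ℝ] E →L[ℝ] E) (v₀ : E)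
    (v : Fin r → E) :
    christoffelAction E r A Γ v₀ v = ∑ i, A (Function.update v i (Γ v₀ (v i))) := by
  simp only [christoffelAction, ContinuousLinearMap.comp_apply, ContinuousLinearMap.compL_apply,
    ContinuousLinearMap.flip_apply, ContinuousMultilinearMap.linearDeriv_apply, _root_.sum_apply,
    ContinuousMultilinearMap.compContinuousLinearMapContinuousMultilinear_apply_apply,
    ContinuousMultilinearMap.compContinuousLinearMap_apply]
  refine Finset.sum_congr rfl fun i _ => ?_
  congr 1
  funext j
  by_cases h : j = i
  · subst h
    simp
  · simp [h]

/-- The iterated covariant differentials of `f` for the connection with Christoffel symbols `Γ`. -/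
def chartTensor (f : E → ℂ) (Γ : E → E →L[ℝ] E →L[ℝ] E) : (r : ℕ) → E → E [×r]→L[ℝ] ℂ
  | 0, y => (continuousMultilinearCurryFin0 ℝ E ℂ).symm (f y)
  | r + 1, y => (continuousMultilinearCurryLeftEquiv ℝ (fun _ : Fin (r + 1) => E) ℂ).symm
      (fderiv ℝ (chartTensor f Γ r) y - christoffelAction E r (chartTensor f Γ r y) (Γ y))

theorem chartTensor_succ_apply (f : E → ℂ) (Γ : E → E →L[ℝ] E →L[ℝ] E) (r : ℕ) (y : E)
    (v : Fin (r + 1) → E) :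
    chartTensor f Γ (r + 1) y v = fderiv ℝ (chartTensor f Γ r) y (v 0) (fun i => v i.succ) -
      ∑ i : Fin r, chartTensor f Γ r y
        (Function.update (fun j : Fin r => v j.succ) i (Γ y (v 0) (v i.succ))) := by
  rw [← christoffelAction_apply (chartTensor f Γ r y) (Γ y) (v 0) fun j => v j.succ]
  rfl

variable {f : E → ℂ} {Γ : E → E →L[ℝ] E →L[ℝ] E} {s : Set E}

theorem contDiffOn_christoffelAction {r : ℕ} {A : E → E [×r]→L[ℝ] ℂ} (hA : ContDiffOn ℝ ∞ A s)
    (hΓ : ContDiffOn ℝ ∞ Γ s) : ContDiffOn ℝ ∞ (fun y => christoffelAction E r (A y) (Γ y)) s :=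
  (contDiffOn_const.clm_apply hA).clm_apply hΓ

theorem contDiffOn_chartTensor (hs : IsOpen s) (hf : ContDiffOn ℝ ∞ f s)
    (hΓ : ContDiffOn ℝ ∞ Γ s) (r : ℕ) : ContDiffOn ℝ ∞ (chartTensor f Γ r) s := by
  induction r with
  | zero => exact (continuousMultilinearCurryFin0 ℝ E ℂ).symm.contDiff.comp_contDiffOn hf
  | succ r ih =>
    exact (continuousMultilinearCurryLeftEquiv ℝ
      (fun _ : Fin (r + 1) => E) ℂ).symm.contDiff.comp_contDiffOn
        ((ih.fderiv_of_isOpen (m := ∞) hs (by simp)).sub (contDiffOn_christoffelAction ih hΓ))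

/-- Each covariant differentiation costs one order through `fderiv`; the Christoffel term costs
none, whatever the value of `Γ`. -/
theorem VanishesTo.chartTensor {p : E} (hs : IsOpen s) (hp : p ∈ s) (hf : ContDiffOn ℝ ∞ f s)
    (hΓ : ContDiffOn ℝ ∞ Γ s) {m r : ℕ} (h : VanishesTo (m + r) f p) :
    VanishesTo m (chartTensor f Γ r) p := by
  induction r generalizing m with
  | zero => exact h.comp_linearIsometryEquiv (continuousMultilinearCurryFin0 ℝ E ℂ).symm
  | succ r ih =>
    have hA := contDiffOn_chartTensor hs hf hΓ r
    have h1 : VanishesTo (m + 1) (_root_.chartTensor f Γ r) p :=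
      ih (by rwa [show m + 1 + r = m + (r + 1) by ring])
    have h2 := h1.bilinear (christoffelAction E r) (vanishesTo_zero Γ p) hA hΓ hs hp
    refine VanishesTo.comp_linearIsometryEquiv (VanishesTo.sub h1.fderiv (h2.mono (by omega)) ?_ ?_)
      (continuousMultilinearCurryLeftEquiv ℝ (fun _ : Fin (r + 1) => E) ℂ).symm
    · exact (hA.fderiv_of_isOpen (m := ∞) hs (by simp)).contDiffAt (hs.mem_nhds hp)
    · exact (contDiffOn_christoffelAction hA hΓ).contDiffAt (hs.mem_nhds hp)

theorem ContDiffOn.iteratedFDeriv_of_isOpen (hf : ContDiffOn ℝ ∞ f s) (hs : IsOpen s) (r : ℕ) :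
    ContDiffOn ℝ ∞ (iteratedFDeriv ℝ r f) s := by
  induction r with
  | zero =>
    rw [iteratedFDeriv_zero_eq_comp]
    exact (continuousMultilinearCurryFin0 ℝ E ℂ).symm.contDiff.comp_contDiffOn hf
  | succ r ih =>
    rw [iteratedFDeriv_succ_eq_comp_left]
    exact (continuousMultilinearCurryLeftEquiv ℝ
      (fun _ : Fin (r + 1) => E) ℂ).symm.contDiff.comp_contDiffOn
        (ih.fderiv_of_isOpen (m := ∞) hs (by simp))

/-- The iterated covariant differential agrees with the iterated differential up to terms of lower
order. -/
theorem VanishesTo.chartTensor_sub_iteratedFDeriv {p : E} (hs : IsOpen s) (hp : p ∈ s)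
    (hf : ContDiffOn ℝ ∞ f s) (hΓ : ContDiffOn ℝ ∞ Γ s) {m r : ℕ}
    (h : VanishesTo (m + r) f p) :
    VanishesTo (m + 1) (fun y => _root_.chartTensor f Γ r y - iteratedFDeriv ℝ r f y) p := by
  induction r generalizing m with
  | zero =>
    have h0 : (fun y => _root_.chartTensor f Γ 0 y - iteratedFDeriv ℝ 0 f y) =
        fun _ => (0 : E [×0]→L[ℝ] ℂ) := by
      funext y
      rw [iteratedFDeriv_zero_eq_comp]
      exact sub_self _
    rw [h0]
    intro j _
    have := iteratedFDeriv_fun_zero (𝕜 := ℝ) (E := E) (F := E [×0]→L[ℝ] ℂ) (n := j)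
    exact congrFun this p
  | succ r ih =>
    have hA := contDiffOn_chartTensor hs hf hΓ r
    have hB := hf.iteratedFDeriv_of_isOpen hs r
    -- One order is shifted from `r` to `m`: the previous difference then vanishes to order `m + 2`,
    -- hence its derivative to order `m + 1`, and so does the Christoffel term.
    have h0 : VanishesTo (m + 1 + r) f p := by rwa [show m + 1 + r = m + (r + 1) by ring]
    have h1 := (ih h0).fderiv
    have h2 := (h0.chartTensor hs hp hf hΓ).bilinear (christoffelAction E r) (vanishesTo_zero Γ p)
      hA hΓ hs hp
    have h3 := VanishesTo.comp_linearIsometryEquiv (h1.sub h2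
        (((hA.sub hB).fderiv_of_isOpen (m := ∞) hs (by simp)).contDiffAt (hs.mem_nhds hp))
        ((contDiffOn_christoffelAction hA hΓ).contDiffAt (hs.mem_nhds hp)))
      (continuousMultilinearCurryLeftEquiv ℝ (fun _ : Fin (r + 1) => E) ℂ).symm
    refine h3.congr ?_
    filter_upwards [hs.mem_nhds hp] with y hy
    rw [iteratedFDeriv_succ_eq_comp_left, Function.comp_apply, _root_.chartTensor, ← map_sub]
    congr 1
    rw [fderiv_fun_sub ((hA.contDiffAt (hs.mem_nhds hy)).differentiableAt (by simp))
      ((hB.contDiffAt (hs.mem_nhds hy)).differentiableAt (by simp))]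
    abel

end ChartTensor

section IteratedCovDeriv

variable {E : Type*} [NormedAddCommGroup E] [NormedSpace ℝ E] [FiniteDimensional ℝ E]
  {M : Type*} [TopologicalSpace M] [T2Space M] [ChartedSpace E M] [IsManifold 𝓘(ℝ, E) ∞ M]
  (cov : CovariantDerivative 𝓘(ℝ, E) E (TangentSpace 𝓘(ℝ, E) : M → Type _))

/-- The iterated covariant differential is tensorial and given by `chartTensor` in a chart. -/
theorem iteratedCovDeriv_eq_chartTensor
    (hsmooth : CovariantDerivative.ContMDiffCovariantDerivative cov ∞)
    (f : SmoothFun E M) (x₀ : M) {D : Set E} (hD : IsOpen D) (hDt : D ⊆ (chartAt E x₀).target)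
    (r : ℕ) (X : Fin r → ∀ x : M, TangentSpace 𝓘(ℝ, E) x)
    (hX : ∀ i, ContDiffOn ℝ ∞ (chartRep x₀ (X i)) D) {y : E} (hy : y ∈ D) :
    iteratedCovDeriv cov (f : M → ℂ) r X ((chartAt E x₀).symm y) =
      chartTensor ((f : M → ℂ) ∘ (chartAt E x₀).symm) (christoffel cov x₀) r y
        (fun i => chartRep x₀ (X i) y) := by
  induction r generalizing y with
  | zero => rfl
  | succ r ih =>
    set φ := chartAt E x₀
    set x := φ.symm y with hxdef
    have hx : x ∈ φ.source := φ.map_target (hDt hy)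
    have hxy : φ x = y := φ.right_inv (hDt hy)
    have hΓ := (contDiffOn_christoffel cov hsmooth x₀).mono hDt
    have hA : ContDiffOn ℝ ∞ (chartTensor ((f : M → ℂ) ∘ φ.symm) (christoffel cov x₀) r) D :=
      contDiffOn_chartTensor hD (((SmoothFun.smooth f).contDiffOn_comp_chart_symm x₀).mono hDt) hΓ r
    set A := chartTensor ((f : M → ℂ) ∘ φ.symm) (christoffel cov x₀) r
    let u : Fin r → E → E := fun i => chartRep x₀ (X i.succ)
    let u₀ : E → E := chartRep x₀ (X 0)
    have hu : ∀ i, ContDiffOn ℝ ∞ (u i) D := fun i => hX i.succ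
    have hAd : HasFDerivAt A (fderiv ℝ A y) y :=
      ((hA.contDiffAt (hD.mem_nhds hy)).differentiableAt (by simp)).hasFDerivAt
    have hud : ∀ i, HasFDerivAt (u i) (fderiv ℝ (u i) y) y := fun i =>
      (((hu i).contDiffAt (hD.mem_nhds hy)).differentiableAt (by simp)).hasFDerivAt
    have hk := hAd.continuousMultilinearMap_apply hud
    have heq : iteratedCovDeriv cov (f : M → ℂ) r (fun i => X i.succ) ∘ φ.symm =ᶠ[nhds y]
        fun z => A z (fun i => u i z) := by
      filter_upwards [hD.mem_nhds hy] with z hz using ih (fun i => X i.succ) hu hz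
    have hkd := hk.congr_of_eventuallyEq heq
    -- The product rule for `A(u₁, …, u_r)` also differentiates the fields; these terms cancel
    -- against the flat part of the `∇_{X₀} X_i` in `hsecond`, leaving only the Christoffel action.
    have hfirst : mvfderiv 𝓘(ℝ, E) (iteratedCovDeriv cov (f : M → ℂ) r (fun i => X i.succ)) x
        (X 0 x) = fderiv ℝ A y (u₀ y) (fun i => u i y) +
          ∑ i, A y (Function.update (fun i => u i y) i (fderiv ℝ (u i) y (u₀ y))) := by
      have hmd : MDifferentiableAt 𝓘(ℝ, E) 𝓘(ℝ, ℂ)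
          (iteratedCovDeriv cov (f : M → ℂ) r (fun i => X i.succ)) x := by
        rw [mdifferentiableAt_iff_comp_chart_symm hx, hxy]
        exact hkd.differentiableAt
      rw [mvfderiv_eq_fderiv_comp_chart_symm hx hmd, hxy, hkd.fderiv]
      simp [u₀, chartRep]
      rfl
    have hsecond : ∀ i : Fin r, iteratedCovDeriv cov (f : M → ℂ) r
        (Function.update (fun j : Fin r => X j.succ) i (fun y => cov (X i.succ) y (X 0 y))) x =
          A y (Function.update (fun i => u i y) i (fderiv ℝ (u i) y (u₀ y))) +
          A y (Function.update (fun i => u i y) i (christoffel cov x₀ y (u₀ y) (u i y))) := by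
      intro i
      have hrep : Set.EqOn (chartRep x₀ fun y => cov (X i.succ) y (X 0 y))
          (fun z => fderiv ℝ (u i) z (u₀ z) + christoffel cov x₀ z (u₀ z) (u i z)) D := by
        intro z hz
        have h := tangentCoord_cov cov (φ.map_target (hDt hz)) (X := X i.succ)
          (by
            rw [φ.right_inv (hDt hz)]
            exact ((hu i).contDiffAt (hD.mem_nhds hz)).differentiableAt (by simp))
          (X 0 (φ.symm z))
        rw [φ.right_inv (hDt hz)] at h
        exact h
      have hcd : ContDiffOn ℝ ∞ (chartRep x₀ fun y => cov (X i.succ) y (X 0 y)) D := by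
        refine ContDiffOn.congr ?_ hrep
        exact (((hu i).fderiv_of_isOpen (m := ∞) hD (by simp)).clm_apply (hX 0)).add
          ((hΓ.clm_apply (hX 0)).clm_apply (hu i))
      -- The induction hypothesis is needed for the new field `∇_{X₀} X_i`, hence smoothness of the
      -- fields on an open set and not merely at `y`.
      have h := ih (Function.update (fun j : Fin r => X j.succ) i
        (fun y => cov (X i.succ) y (X 0 y))) (fun j => by
          by_cases hj : j = i
          · subst hj
            simpa using hcd
          · simpa [hj] using hu j) hy
      have hrepy := hrep hy
      simp only at hrepy
      rw [h, ← ContinuousMultilinearMap.map_update_add, ← hrepy]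
      congr 1
      funext j
      by_cases hj : j = i
      · subst hj
        simp
      · simp [hj, u]
    rw [iteratedCovDeriv, hfirst, Finset.sum_congr rfl fun i _ => hsecond i, chartTensor_succ_apply,
      Finset.sum_add_distrib]
    ring

end IteratedCovDeriv

/-! ### Quantization -/

section ChartTensorLinear

variable {E : Type*} [NormedAddCommGroup E] [NormedSpace ℝ E]

theorem chartTensor_add {f g : E → ℂ} {Γ : E → E →L[ℝ] E →L[ℝ] E} {s : Set E} (hs : IsOpen s)
    (hf : ContDiffOn ℝ ∞ f s) (hg : ContDiffOn ℝ ∞ g s) (hΓ : ContDiffOn ℝ ∞ Γ s) (r : ℕ)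
    {y : E} (hy : y ∈ s) :
    chartTensor (f + g) Γ r y = chartTensor f Γ r y + chartTensor g Γ r y := by
  induction r generalizing y with
  | zero => rfl
  | succ r ih =>
    have hA := ((contDiffOn_chartTensor hs hf hΓ r).contDiffAt (hs.mem_nhds hy)).differentiableAt
      (by simp)
    have hB := ((contDiffOn_chartTensor hs hg hΓ r).contDiffAt (hs.mem_nhds hy)).differentiableAt
      (by simp)
    have h : chartTensor (f + g) Γ r =ᶠ[nhds y]
        fun z => chartTensor f Γ r z + chartTensor g Γ r z := by
      filter_upwards [hs.mem_nhds hy] with z hz using ih hz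
    ext v
    rw [_root_.add_apply]
    simp only [chartTensor_succ_apply]
    rw [h.fderiv_eq, fderiv_fun_add hA hB, ih hy]
    simp only [_root_.add_apply, Finset.sum_add_distrib]
    ring

theorem chartTensor_const_smul (c : ℂ) {f : E → ℂ} {Γ : E → E →L[ℝ] E →L[ℝ] E} {s : Set E}
    (hs : IsOpen s) (hf : ContDiffOn ℝ ∞ f s) (hΓ : ContDiffOn ℝ ∞ Γ s) (r : ℕ)
    {y : E} (hy : y ∈ s) :
    chartTensor (c • f) Γ r y = c • chartTensor f Γ r y := by
  induction r generalizing y with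
  | zero => rfl
  | succ r ih =>
    have hA := ((contDiffOn_chartTensor hs hf hΓ r).contDiffAt (hs.mem_nhds hy)).differentiableAt
      (by simp)
    have h : chartTensor (c • f) Γ r =ᶠ[nhds y] fun z => c • chartTensor f Γ r z := by
      filter_upwards [hs.mem_nhds hy] with z hz using ih hz
    ext v
    rw [_root_.smul_apply]
    simp only [chartTensor_succ_apply]
    rw [h.fderiv_eq, fderiv_fun_const_smul hA, ih hy]
    simp only [_root_.smul_apply, ← Finset.smul_sum, smul_sub]

end ChartTensorLinear

section Quantization

variable {E : Type*} [NormedAddCommGroup E] [NormedSpace ℝ E] [FiniteDimensional ℝ E]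
  {M : Type*} [TopologicalSpace M] [T2Space M] [ChartedSpace E M] [IsManifold 𝓘(ℝ, E) ∞ M]
  {cov : CovariantDerivative 𝓘(ℝ, E) E (TangentSpace 𝓘(ℝ, E) : M → Type _)}

theorem extend_eq_tangentFrame {x : M} (v : TangentSpace 𝓘(ℝ, E) x) {z : M}
    (hz : z ∈ (chartAt E x).source) :
    FiberBundle.extend E v z = tangentFrame x z (tangentCoord x x v) := by
  have h1 : tangentCoord x x v = (trivializationAt E (TangentSpace 𝓘(ℝ, E)) x ⟨x, v⟩).2 :=
    Bundle.Trivialization.continuousLinearMapAt_apply_of_mem (R := ℝ) _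
      (FiberBundle.mem_baseSet_trivializationAt' x) _
  rw [h1]
  exact (Bundle.Trivialization.symmL_apply (R := ℝ) _ hz _).symm

/-- The covariant differential at a point, in the chart at a nearby point. -/
theorem iteratedCovDerivAt_eq_chartTensor
    (hsmooth : CovariantDerivative.ContMDiffCovariantDerivative cov ∞)
    (f : SmoothFun E M) (r : ℕ) {x₀ x : M} (hx : x ∈ (chartAt E x₀).source)
    (v : Fin r → TangentSpace 𝓘(ℝ, E) x) :
    iteratedCovDerivAt cov (f : M → ℂ) r x v =
      chartTensor ((f : M → ℂ) ∘ (chartAt E x₀).symm) (christoffel cov x₀) r (chartAt E x₀ x)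
        (fun i => tangentCoord x₀ x (v i)) := by
  -- The vectors are extended with constant coefficients in the chart at `x`, while the computation
  -- takes place in the chart at `x₀`; the extensions are known to be smooth only over the overlap.
  have hD : IsOpen ((chartAt E x₀).target ∩ (chartAt E x₀).symm ⁻¹' (chartAt E x).source) :=
    (chartAt E x₀).isOpen_inter_preimage_symm (chartAt E x).open_source
  have hy : chartAt E x₀ x ∈
      (chartAt E x₀).target ∩ (chartAt E x₀).symm ⁻¹' (chartAt E x).source :=
    ⟨(chartAt E x₀).map_source hx, by
      rw [Set.mem_preimage, (chartAt E x₀).left_inv hx]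
      exact mem_chart_source E x⟩
  have h := iteratedCovDeriv_eq_chartTensor cov hsmooth f x₀ hD Set.inter_subset_left r
    (fun i => FiberBundle.extend E (v i)) (fun i z hz => ?_) hy
  · rw [(chartAt E x₀).left_inv hx] at h
    refine h.trans ?_
    congr 1
    funext i
    rw [chartRep_apply hx, FiberBundle.extend_apply_self]
  · apply ContDiffAt.contDiffWithinAt
    have hz0 := (chartAt E x₀).map_target hz.1
    rw [← (chartAt E x₀).right_inv hz.1]
    refine (contMDiffAt_section_iff_chartRep le_rfl hz0).1 ?_
    refine (contMDiffAt_tangentFrame hz.2 (tangentCoord x x (v i))).congr_of_eventuallyEq ?_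
    filter_upwards [(chartAt E x).open_source.mem_nhds hz.2] with w hw
    rw [extend_eq_tangentFrame _ hw]

/-- The covariant differential at a point, as a multilinear map. -/
def covDerivTensor (cov : CovariantDerivative 𝓘(ℝ, E) E (TangentSpace 𝓘(ℝ, E) : M → Type _))
    (f : SmoothFun E M) (r : ℕ) (x₀ x : M) :
    MultilinearMap ℝ (fun _ : Fin r => TangentSpace 𝓘(ℝ, E) x) ℂ :=
  (chartTensor ((f : M → ℂ) ∘ (chartAt E x₀).symm) (christoffel cov x₀) r
    (chartAt E x₀ x)).toMultilinearMap.compLinearMap fun _ => (tangentCoord x₀ x).toLinearMap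

theorem iteratedCovDerivAt_eq_covDerivTensor
    (hsmooth : CovariantDerivative.ContMDiffCovariantDerivative cov ∞)
    (f : SmoothFun E M) (r : ℕ) {x₀ x : M} (hx : x ∈ (chartAt E x₀).source) :
    iteratedCovDerivAt cov (f : M → ℂ) r x = covDerivTensor cov f r x₀ x :=
  funext fun v => iteratedCovDerivAt_eq_chartTensor hsmooth f r hx v

theorem iteratedCovDerivAt_self
    (hsmooth : CovariantDerivative.ContMDiffCovariantDerivative cov ∞)
    (f : SmoothFun E M) (r : ℕ) (x : M) (v : Fin r → TangentSpace 𝓘(ℝ, E) x) :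
    iteratedCovDerivAt cov (f : M → ℂ) r x v =
      chartTensor ((f : M → ℂ) ∘ (chartAt E x).symm) (christoffel cov x) r (chartAt E x x) v := by
  refine (iteratedCovDerivAt_eq_chartTensor hsmooth f r (mem_chart_source E x) v).trans ?_
  congr 1
  funext i
  exact tangentCoord_self x (v i)

/-- On functions vanishing to order `r` at `x`, the `r`-th covariant differential is the
`r`-th differential. -/
theorem iteratedCovDerivAt_eq_iteratedDiffAt
    (hsmooth : CovariantDerivative.ContMDiffCovariantDerivative cov ∞) {r : ℕ} {x : M}
    {f : SmoothFun E M} (hf : f ∈ (vanishingIdeal x : Ideal (SmoothFun E M)) ^ r) :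
    iteratedCovDerivAt cov (f : M → ℂ) r x = iteratedDiffAt (f : M → ℂ) r x := by
  funext v
  rw [iteratedCovDerivAt_self hsmooth]
  have h := VanishesTo.chartTensor_sub_iteratedFDeriv (m := 0) (r := r)
    (chartAt E x).open_target (chartAt_mem_target x)
    ((SmoothFun.smooth f).contDiffOn_comp_chart_symm x) (contDiffOn_christoffel cov hsmooth x)
    (by simpa using vanishesTo_of_mem_pow hf)
  exact congrArg (fun A => A v) (sub_eq_zero.1 (h.eq_zero (by omega)))

theorem iteratedCovDerivAt_eq_zero
    (hsmooth : CovariantDerivative.ContMDiffCovariantDerivative cov ∞) {r : ℕ} {x : M}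
    {f : SmoothFun E M} (hf : f ∈ (vanishingIdeal x : Ideal (SmoothFun E M)) ^ (r + 1)) :
    iteratedCovDerivAt cov (f : M → ℂ) r x = 0 := by
  funext v
  rw [iteratedCovDerivAt_self hsmooth]
  have h := VanishesTo.chartTensor (m := 1) (r := r)
    (chartAt E x).open_target (chartAt_mem_target x)
    ((SmoothFun.smooth f).contDiffOn_comp_chart_symm x) (contDiffOn_christoffel cov hsmooth x)
    (by simpa [add_comm] using vanishesTo_of_mem_pow hf)
  exact congrArg (fun A => A v) (h.eq_zero (by omega))

theorem iteratedCovDerivAt_add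
    (hsmooth : CovariantDerivative.ContMDiffCovariantDerivative cov ∞) (f g : SmoothFun E M)
    (r : ℕ) (x : M) : iteratedCovDerivAt cov ((f + g : SmoothFun E M) : M → ℂ) r x =
      fun v => iteratedCovDerivAt cov (f : M → ℂ) r x v +
        iteratedCovDerivAt cov (g : M → ℂ) r x v := by
  funext v
  simp only [iteratedCovDerivAt_self hsmooth]
  exact congrArg (fun A => A v) (chartTensor_add (chartAt E x).open_target
    ((SmoothFun.smooth f).contDiffOn_comp_chart_symm x)
    ((SmoothFun.smooth g).contDiffOn_comp_chart_symm x)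
    (contDiffOn_christoffel cov hsmooth x) r (chartAt_mem_target x))

theorem iteratedCovDerivAt_smul
    (hsmooth : CovariantDerivative.ContMDiffCovariantDerivative cov ∞) (c : ℂ)
    (f : SmoothFun E M) (r : ℕ) (x : M) :
    iteratedCovDerivAt cov ((c • f : SmoothFun E M) : M → ℂ) r x =
      fun v => c * iteratedCovDerivAt cov (f : M → ℂ) r x v := by
  funext v
  simp only [iteratedCovDerivAt_self hsmooth]
  exact congrArg (fun A => A v) (chartTensor_const_smul c (chartAt E x).open_target
    ((SmoothFun.smooth f).contDiffOn_comp_chart_symm x)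
    (contDiffOn_christoffel cov hsmooth x) r (chartAt_mem_target x))

/-- The coordinate basis of the tangent space at a point of the chart at `x₀`. -/
def tangentBasis {x₀ x : M} (hx : x ∈ (chartAt E x₀).source) :
    Module.Basis (Fin (Module.finrank ℝ E)) ℝ (TangentSpace 𝓘(ℝ, E) x) :=
  (Module.finBasis ℝ E).map
    (LinearEquiv.ofLinearMap (tangentFrame x₀ x).toLinearMap (tangentCoord x₀ x).toLinearMap
      (LinearMap.ext (tangentFrame_coord hx)) (LinearMap.ext (tangentCoord_frame hx)))

theorem tangentBasis_apply {x₀ x : M} (hx : x ∈ (chartAt E x₀).source)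
    (j : Fin (Module.finrank ℝ E)) :
    tangentBasis hx j = tangentFrame x₀ x (Module.finBasis ℝ E j) := by
  simp [tangentBasis]

theorem tangentBasis_coord {x₀ x : M} (hx : x ∈ (chartAt E x₀).source)
    (j : Fin (Module.finrank ℝ E)) (v : TangentSpace 𝓘(ℝ, E) x) :
    (tangentBasis hx).coord j v = (Module.finBasis ℝ E).coord j (tangentCoord x₀ x v) := by
  simp [tangentBasis]

/-- A global smooth function which is the `j`-th coordinate near `x₀`. -/
def coordCutoff (x₀ : M) (j : Fin (Module.finrank ℝ E)) : M → ℝ :=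
  chartCutoff x₀ ((Module.finBasis ℝ E).coord j)

theorem contMDiff_coordCutoff (x₀ : M) (j : Fin (Module.finrank ℝ E)) :
    ContMDiff 𝓘(ℝ, E) 𝓘(ℝ, ℝ) ∞ (coordCutoff (E := E) x₀ j) :=
  contMDiff_chartCutoff x₀
    (LinearMap.toContinuousLinearMap ((Module.finBasis ℝ E).coord j)).contDiff

/-- The cutoff is `1` on a neighbourhood of `x₀`. Smoothness of a tensor field is tested on global
functions, and these have the coordinate covectors as differentials at all points near `x₀`. -/
theorem mvfderiv_coordCutoff (x₀ : M) (j : Fin (Module.finrank ℝ E)) :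
    ∀ᶠ x in nhds x₀, ∀ hx : x ∈ (chartAt E x₀).source,
      (mvfderiv 𝓘(ℝ, E) (coordCutoff (E := E) x₀ j) x).toLinearMap =
        (tangentBasis hx).coord j := by
  have h0 := (chartCutoff_comp_chart_symm x₀
    ((Module.finBasis ℝ E).coord j)).eventuallyEq_nhds
  have h1 := ((chartAt E x₀).continuousAt (mem_chart_source E x₀)).eventually h0
  filter_upwards [h1] with x h hx
  apply LinearMap.ext
  intro v
  rw [tangentBasis_coord hx]
  refine (mvfderiv_eq_fderiv_comp_chart_symm hx
    ((contMDiff_coordCutoff x₀ j x).mdifferentiableAt (by simp)) v).trans ?_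
  have h2 : fderiv ℝ (coordCutoff (E := E) x₀ j ∘ (chartAt E x₀).symm) (chartAt E x₀ x) =
      LinearMap.toContinuousLinearMap ((Module.finBasis ℝ E).coord j) :=
    (Filter.EventuallyEq.fderiv_eq h).trans
      (LinearMap.toContinuousLinearMap ((Module.finBasis ℝ E).coord j)).fderiv
  rw [h2]
  rfl

theorem quantized_eq (cov : CovariantDerivative 𝓘(ℝ, E) E (TangentSpace 𝓘(ℝ, E) : M → Type _))
    (ħ : ℝ) {r : ℕ} (Φ : SymTensorField E M r) (f : SmoothFun E M) (x : M) :
    quantized cov ħ Φ f x = (-Complex.I * (ħ : ℂ)) ^ r *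
      contraction (Φ.1 x) (iteratedCovDerivAt cov (f : M → ℂ) r x) := by
  rw [quantized, contraction_symmetrization (Φ.2.1 x)]

/-- The definition uses a different chart at each point. Near `x₀` the contraction is rewritten in
the coordinate basis of the one chart at `x₀`, where the components of both tensors are smooth; the
change of basis is legitimate because the covariant differential is multilinear. -/
theorem contMDiff_quantized (hsmooth : CovariantDerivative.ContMDiffCovariantDerivative cov ∞)
    (ħ : ℝ) {r : ℕ} (Φ : SymTensorField E M r) (f : SmoothFun E M) :
    ContMDiff 𝓘(ℝ, E) 𝓘(ℝ, ℂ) ∞ (quantized cov ħ Φ f) := by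
  intro x₀
  let u : (Fin r → Fin (Module.finrank ℝ E)) → M → ℂ := fun J x =>
    chartTensor ((f : M → ℂ) ∘ (chartAt E x₀).symm) (christoffel cov x₀) r (chartAt E x₀ x)
      (fun i => Module.finBasis ℝ E (J i))
  let w : (Fin r → Fin (Module.finrank ℝ E)) → M → ℂ := fun J x =>
    Φ.1 x (fun i => (mvfderiv 𝓘(ℝ, E) (coordCutoff (E := E) x₀ (J i)) x).toLinearMap)
  have hu : ∀ J, ContMDiffAt 𝓘(ℝ, E) 𝓘(ℝ, ℂ) ∞ (u J) x₀ := by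
    intro J
    have h1 := (contDiffOn_chartTensor (chartAt E x₀).open_target
      ((SmoothFun.smooth f).contDiffOn_comp_chart_symm x₀)
      (contDiffOn_christoffel cov hsmooth x₀) r).contDiffAt
        ((chartAt E x₀).open_target.mem_nhds (chartAt_mem_target x₀))
    have h2 := (ContinuousMultilinearMap.apply ℝ (fun _ : Fin r => E) ℂ
      (fun i => Module.finBasis ℝ E (J i))).contDiff.contDiffAt.comp (chartAt E x₀ x₀) h1
    exact h2.contMDiffAt.comp x₀ ((contMDiffOn_chart (I := 𝓘(ℝ, E)) (n := ∞)
      (x := x₀)).contMDiffAt ((chartAt E x₀).open_source.mem_nhds (mem_chart_source E x₀)))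
  have hw : ∀ J, ContMDiff 𝓘(ℝ, E) 𝓘(ℝ, ℂ) ∞ (w J) := fun J =>
    Φ.2.2 _ fun i => contMDiff_coordCutoff x₀ (J i)
  have hmul : ContDiff ℝ ∞ (fun p : ℂ × ℂ => p.1 * p.2) := contDiff_fst.mul contDiff_snd
  have hsum : ContMDiffAt 𝓘(ℝ, E) 𝓘(ℝ, ℂ) ∞
      (fun x => (-Complex.I * (ħ : ℂ)) ^ r * ∑ J, w J x * u J x) x₀ := by
    refine hmul.contMDiff.contMDiffAt.comp x₀ (contMDiffAt_const.prodMk_space ?_)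
    refine ContMDiffAt.sum fun J _ => ?_
    exact hmul.contMDiff.contMDiffAt.comp x₀ ((hw J x₀).prodMk_space (hu J))
  refine hsum.congr_of_eventuallyEq ?_
  filter_upwards [(chartAt E x₀).open_source.mem_nhds (mem_chart_source E x₀),
    Filter.eventually_all.2 fun j => mvfderiv_coordCutoff (E := E) x₀ j] with x hx hcoord
  rw [quantized_eq, iteratedCovDerivAt_eq_covDerivTensor hsmooth f r hx,
    contraction_eq_sum_basis (tangentBasis hx)]
  congr 1
  refine Finset.sum_congr rfl fun J _ => ?_
  congr 1
  · exact congrArg (Φ.1 x) (funext fun i => (hcoord (J i) hx).symm)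
  · refine congrArg (chartTensor _ _ r _) (funext fun i => ?_)
    change tangentCoord x₀ x (tangentBasis hx (J i)) = _
    rw [tangentBasis_apply]
    exact tangentCoord_frame hx _

/-- The quantized of a tensor field, as a linear operator on smooth functions. -/
def quantizedOp (hsmooth : CovariantDerivative.ContMDiffCovariantDerivative cov ∞) (ħ : ℝ)
    {r : ℕ} (Φ : SymTensorField E M r) : Module.End ℂ (SmoothFun E M) where
  toFun f := ⟨quantized cov ħ Φ f, contMDiff_quantized hsmooth ħ Φ f⟩
  map_add' f g := by
    ext x
    change quantized cov ħ Φ (f + g) x = quantized cov ħ Φ f x + quantized cov ħ Φ g x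
    simp only [quantized_eq, iteratedCovDerivAt_add hsmooth, contraction_add, mul_add]
  map_smul' c f := by
    ext x
    change quantized cov ħ Φ (c • f) x = c * quantized cov ħ Φ f x
    simp only [quantized_eq, iteratedCovDerivAt_smul hsmooth, contraction_mul_left]
    ring

theorem quantizedOp_apply (hsmooth : CovariantDerivative.ContMDiffCovariantDerivative cov ∞)
    (ħ : ℝ) {r : ℕ} (Φ : SymTensorField E M r) (f : SmoothFun E M) (x : M) :
    (quantizedOp hsmooth ħ Φ f : M → ℂ) x = (-Complex.I * (ħ : ℂ)) ^ r *
      contraction (Φ.1 x) (iteratedCovDerivAt cov (f : M → ℂ) r x) :=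
  quantized_eq cov ħ Φ f x

/-- At `x`, `∇^r f` vanishes for `f` in `m_x ^ (r + 1)`, which gives the order, and equals `d^r f`
for `f` in `m_x ^ r`, which gives the symbol. -/
theorem hasSymbol_quantizedOp (hsmooth : CovariantDerivative.ContMDiffCovariantDerivative cov ∞)
    (ħ : ℝ) {r : ℕ} (Φ : SymTensorField E M r) :
    HasSymbol r (quantizedOp hsmooth ħ Φ) ((-Complex.I * (ħ : ℂ)) ^ r • Φ) := by
  refine ⟨fun x f hf => ?_, fun x f hf => ?_⟩
  · refine (quantizedOp_apply hsmooth ħ Φ f x).trans ?_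
    rw [iteratedCovDerivAt_eq_zero hsmooth hf]
    simp [contraction]
  · refine (quantizedOp_apply hsmooth ħ Φ f x).trans ?_
    rw [iteratedCovDerivAt_eq_iteratedDiffAt hsmooth hf]
    exact (smul_contraction _ _ _).symm

/-- Quantization of homogeneous tensor fields, as a linear map. -/
def quantizationHom (hsmooth : CovariantDerivative.ContMDiffCovariantDerivative cov ∞) (ħ : ℝ)
    (r : ℕ) : SymTensorField E M r →ₗ[ℂ] DiffOp E M where
  toFun Φ := ⟨quantizedOp hsmooth ħ Φ, r, (hasSymbol_quantizedOp hsmooth ħ Φ).1⟩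
  map_add' Φ Ψ := by
    apply Subtype.ext
    ext f x
    refine (quantizedOp_apply hsmooth ħ _ f x).trans ?_
    refine Eq.trans ?_ (congrArg₂ (· + ·) (quantizedOp_apply hsmooth ħ Φ f x)
      (quantizedOp_apply hsmooth ħ Ψ f x)).symm
    change _ * contraction (Φ.1 x + Ψ.1 x) _ = _
    rw [add_contraction, mul_add]
  map_smul' c Φ := by
    apply Subtype.ext
    ext f x
    refine (quantizedOp_apply hsmooth ħ _ f x).trans ?_
    refine Eq.trans ?_ (congrArg (c * ·) (quantizedOp_apply hsmooth ħ Φ f x)).symm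
    change _ * contraction (c • Φ.1 x) _ = c * (_ * _)
    rw [smul_contraction]
    ring

theorem hasSymbol_quantizationHom
    (hsmooth : CovariantDerivative.ContMDiffCovariantDerivative cov ∞)
    (ħ : ℝ) {r : ℕ} (Φ : SymTensorField E M r) :
    HasSymbol r (quantizationHom hsmooth ħ r Φ).1 ((-Complex.I * (ħ : ℂ)) ^ r • Φ) :=
  hasSymbol_quantizedOp hsmooth ħ Φ

end Quantization

/-! ### Triangular descent: decomposing operators into quantized homogeneous tensors -/

section Decomposition

variable {E : Type*} [NormedAddCommGroup E] [NormedSpace ℝ E] [FiniteDimensional ℝ E]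
  {M : Type*} [TopologicalSpace M] [T2Space M] [ChartedSpace E M] [IsManifold 𝓘(ℝ, E) ∞ M]
  {cov : CovariantDerivative 𝓘(ℝ, E) E (TangentSpace 𝓘(ℝ, E) : M → Type _)}
  (hsmooth : CovariantDerivative.ContMDiffCovariantDerivative cov ∞) {ħ : ℝ}

theorem hasSymbol_zero_zero (r : ℕ) :
    HasSymbol r (0 : Module.End ℂ (SmoothFun E M)) 0 :=
  ⟨fun x _ _ => Ideal.zero_mem (vanishingIdeal x), fun x f _ => by simp [contraction]⟩

theorem hasSymbol_sum_of_lt (Φ : ∀ j, SymTensorField E M j) {s : Finset ℕ} {r : ℕ}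
    (hs : ∀ j ∈ s, j < r) :
    HasSymbol r (∑ j ∈ s, (quantizationHom hsmooth ħ j (Φ j)).1) 0 :=
  Finset.sum_induction _ (fun P => HasSymbol r P 0)
    (fun P Q hP hQ => by simpa using hP.add hQ) (hasSymbol_zero_zero r)
    fun j hj => (hasSymbol_quantizationHom hsmooth ħ (Φ j)).1.hasSymbol_zero (hs j hj)

theorem hasSymbol_sum_range (Φ : ∀ j, SymTensorField E M j) (r : ℕ) :
    HasSymbol r (∑ j ∈ Finset.range (r + 1), (quantizationHom hsmooth ħ j (Φ j)).1)
      ((-Complex.I * (ħ : ℂ)) ^ r • Φ r) := by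
  rw [Finset.sum_range_succ]
  simpa using (hasSymbol_sum_of_lt hsmooth Φ (s := Finset.range r) (r := r)
    fun j hj => Finset.mem_range.1 hj).add (hasSymbol_quantizationHom hsmooth ħ (Φ r))

theorem quantization_const_ne_zero (hħ : ħ ≠ 0) (r : ℕ) :
    (-Complex.I * (ħ : ℂ)) ^ r ≠ 0 :=
  pow_ne_zero _ (mul_ne_zero (neg_ne_zero.2 Complex.I_ne_zero) (Complex.ofReal_ne_zero.2 hħ))

/-- Since `ħ ≠ 0`, the symbol of `P` may be divided by `(-iħ)^r`; quantizing the quotient reproduces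
that symbol. -/
theorem IsDiffOpOfOrder.exists_hasSymbol_sub_zero (hħ : ħ ≠ 0) {r : ℕ}
    {P : Module.End ℂ (SmoothFun E M)} (hP : IsDiffOpOfOrder r P) :
    ∃ Ψ : SymTensorField E M r, HasSymbol r (P - (quantizationHom hsmooth ħ r Ψ).1) 0 := by
  let Ψ := ((-Complex.I * (ħ : ℂ)) ^ r)⁻¹ • hP.symbol
  refine ⟨Ψ, ?_⟩
  have h1 := hP.hasSymbol.add (hasSymbol_quantizationHom hsmooth ħ (-Ψ))
  have h2 : hP.symbol + (-Complex.I * (ħ : ℂ)) ^ r • (-Ψ) = 0 := by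
    rw [smul_neg, smul_inv_smul₀ (quantization_const_ne_zero hħ r), add_neg_cancel]
  have h3 : quantizationHom hsmooth ħ r (-Ψ) + quantizationHom hsmooth ħ r Ψ = 0 := by
    rw [← map_add, neg_add_cancel, map_zero]
  have h4 : P + (quantizationHom hsmooth ħ r (-Ψ)).1 = P - (quantizationHom hsmooth ħ r Ψ).1 := by
    refine eq_sub_of_add_eq (G := Module.End ℂ (SmoothFun E M)) ?_
    rw [add_assoc]
    exact (congrArg (P + ·) (congrArg Subtype.val h3)).trans (add_zero P)
  rwa [h2, h4] at h1

/-- Subtracting the quantized top component leaves zero symbol, hence an operator of order one less,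
to which induction applies. -/
theorem IsDiffOpOfOrder.exists_eq_sum (hħ : ħ ≠ 0) {r : ℕ} {P : Module.End ℂ (SmoothFun E M)}
    (hP : IsDiffOpOfOrder r P) : ∃ Φ : ∀ j, SymTensorField E M j, (∀ j, r < j → Φ j = 0) ∧
      P = ∑ j ∈ Finset.range (r + 1), (quantizationHom hsmooth ħ j (Φ j)).1 := by
  induction r generalizing P with
  | zero =>
    obtain ⟨Ψ, hΨ⟩ := hP.exists_hasSymbol_sub_zero hsmooth hħ
    refine ⟨Function.update 0 0 Ψ, fun j hj => by simp [hj.ne'], ?_⟩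
    simpa using sub_eq_zero.1 hΨ.eq_zero_of_zero
  | succ r ih =>
    obtain ⟨Ψ, hΨ⟩ := hP.exists_hasSymbol_sub_zero hsmooth hħ
    obtain ⟨Φ, hΦ, hsum⟩ := ih hΨ.isDiffOpOfOrder_of_zero
    refine ⟨Function.update Φ (r + 1) Ψ, fun j hj => ?_, ?_⟩
    · rw [Function.update_of_ne hj.ne']
      exact hΦ j (by omega)
    · rw [Finset.sum_range_succ, Function.update_self]
      refine (sub_eq_iff_eq_add.1 hsum).trans (congrArg (· + _) ?_)
      refine Finset.sum_congr rfl fun j hj => ?_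
      rw [Function.update_of_ne (Finset.mem_range.1 hj).ne]

theorem DirectSum.sum_range_lof_apply {R : Type*} [Semiring R] {V : ℕ → Type*}
    [∀ j, AddCommMonoid (V j)] [∀ j, Module R (V j)] (v : ∀ j, V j) {n : ℕ}
    (hv : ∀ j, n ≤ j → v j = 0) (i : ℕ) :
    (∑ j ∈ Finset.range n, DirectSum.lof R ℕ V j (v j)) i = v i := by
  rw [DirectSum.sum_apply]
  by_cases hi : i < n
  · rw [Finset.sum_eq_single_of_mem i (Finset.mem_range.2 hi) fun j _ hj =>
      DirectSum.of_eq_of_ne _ _ _ hj.symm]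
    exact DirectSum.of_eq_same _ _
  · rw [hv i (not_lt.1 hi)]
    refine Finset.sum_eq_zero fun j hj => DirectSum.of_eq_of_ne _ _ _ ?_
    have := Finset.mem_range.1 hj
    omega

/-- Quantization of not necessarily homogeneous tensor fields. -/
def quantization (ħ : ℝ) : (⨁ r : ℕ, SymTensorField E M r) →ₗ[ℂ] DiffOp E M :=
  DirectSum.toModule ℂ ℕ _ (quantizationHom hsmooth ħ)

theorem quantization_lof (r : ℕ) (Φ : SymTensorField E M r) :
    quantization hsmooth ħ (DirectSum.lof ℂ ℕ (fun j => SymTensorField E M j) r Φ) =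
      quantizationHom hsmooth ħ r Φ :=
  DirectSum.toModule_lof _ _ _

theorem quantization_sum_lof (Φ : ∀ j, SymTensorField E M j) (s : Finset ℕ) :
    (quantization hsmooth ħ
      (∑ j ∈ s, DirectSum.lof ℂ ℕ (fun j => SymTensorField E M j) j (Φ j))).1 =
      ∑ j ∈ s, (quantizationHom hsmooth ħ j (Φ j)).1 := by
  rw [map_sum]
  simp only [quantization_lof]
  exact map_sum (DiffOp E M).subtype _ _

/-- If the components from `n + 1` on vanish, the zero operator has both `0` and `(-iħ)^n Φ_n` as
symbol of order `n`. Uniqueness kills `Φ_n`, and the bound descends to `0`. -/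
theorem quantization_injective (hħ : ħ ≠ 0) :
    Function.Injective (quantization (M := M) (E := E) hsmooth ħ) := by
  rw [injective_iff_map_eq_zero]
  have key : ∀ (n : ℕ) (Φ : ⨁ r : ℕ, SymTensorField E M r), quantization hsmooth ħ Φ = 0 →
      (∀ j, n ≤ j → Φ j = 0) → Φ = 0 := by
    intro n
    induction n with
    | zero => exact fun Φ _ h => DFinsupp.ext fun j => h j (Nat.zero_le j)
    | succ n ih =>
      intro Φ hΦ h
      have heq : Φ = ∑ j ∈ Finset.range (n + 1),
          DirectSum.lof ℂ ℕ (fun j => SymTensorField E M j) j (Φ j) :=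
        DFinsupp.ext fun j => (DirectSum.sum_range_lof_apply _ h j).symm
      have hsum : ∑ j ∈ Finset.range (n + 1), (quantizationHom hsmooth ħ j (Φ j)).1 = 0 := by
        rw [← quantization_sum_lof, ← heq, hΦ]
        rfl
      have hsym := hasSymbol_sum_range (ħ := ħ) hsmooth (fun j => Φ j) n
      rw [hsum] at hsym
      have hn := (smul_eq_zero.1 (hsym.unique (hasSymbol_zero_zero n))).resolve_left
        (quantization_const_ne_zero hħ n)
      refine ih Φ hΦ fun j hj => ?_
      rcases hj.eq_or_lt with rfl | hj
      · exact hn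
      · exact h j hj
  intro Φ hΦ
  classical
  -- A direct sum element has finite support, so all components past its largest index vanish.
  refine key (Φ.support.sup id + 1) Φ hΦ fun j hj => ?_
  by_contra hne
  have := Finset.le_sup (f := id) (DFinsupp.mem_support_iff.2 hne)
  simp only [id] at this
  omega

theorem quantization_surjective (hħ : ħ ≠ 0) :
    Function.Surjective (quantization (M := M) (E := E) hsmooth ħ) := by
  rintro ⟨P, r, hP⟩
  obtain ⟨Φ, -, h⟩ := IsDiffOpOfOrder.exists_eq_sum hsmooth hħ hP
  exact ⟨_, Subtype.ext ((quantization_sum_lof hsmooth Φ _).trans h.symm)⟩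

end Decomposition

end

/-! ### The main theorem -/

theorem mainTheorem2 {E : Type*} [NormedAddCommGroup E] [NormedSpace ℝ E] [FiniteDimensional ℝ E]
    {M : Type*} [TopologicalSpace M] [T2Space M] [ChartedSpace E M] [IsManifold 𝓘(ℝ, E) ∞ M]
    (cov : CovariantDerivative 𝓘(ℝ, E) E (TangentSpace 𝓘(ℝ, E) : M → Type _))
    (hsmooth : CovariantDerivative.ContMDiffCovariantDerivative cov ∞)
    (hsymm : cov.torsion = 0) (ħ : ℝ) (hħ : ħ ≠ 0) :
    -- symbols exist and are unique
    (∀ (r : ℕ) (P : Module.End ℂ (SmoothFun E M)), IsDiffOpOfOrder r P →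
      ∃! S : SymTensorField E M r, HasSymbol r P S) ∧
    -- quantization is a linear bijection
    ∃ Q : (⨁ r : ℕ, SymTensorField E M r) ≃ₗ[ℂ] DiffOp E M,
      (∀ (r : ℕ) (Φ : SymTensorField E M r) (f : SmoothFun E M) (x : M),
        ((Q (DirectSum.lof ℂ ℕ (fun j => SymTensorField E M j) r Φ)).1 f : M → ℂ) x =
          quantized cov ħ Φ f x) ∧
      -- recursive recovery of the homogeneous components
      ∀ (r : ℕ) (P : DiffOp E M), IsDiffOpOfOrder r P.1 →
        ∃ Φ : ∀ j : ℕ, SymTensorField E M j,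
          (∀ j, Q.symm P j = Φ j) ∧
          (∀ j, r < j → Φ j = 0) ∧
          HasSymbol r P.1 ((-Complex.I * (ħ : ℂ)) ^ r • Φ r) ∧
          (∀ k, 1 ≤ k → k ≤ r →
            HasSymbol (r - k)
              (P.1 - ∑ j ∈ Finset.Ioc (r - k) r,
                (Q (DirectSum.lof ℂ ℕ (fun j => SymTensorField E M j) j (Φ j))).1)
              ((-Complex.I * (ħ : ℂ)) ^ (r - k) • Φ (r - k))) ∧
          P = ∑ j ∈ Finset.range (r + 1),
            Q (DirectSum.lof ℂ ℕ (fun j => SymTensorField E M j) j (Φ j)) := by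
  refine ⟨fun r P hP => ⟨hP.symbol, hP.hasSymbol, fun S hS => hS.unique hP.hasSymbol⟩, ?_⟩
  let Q : (⨁ r : ℕ, SymTensorField E M r) ≃ₗ[ℂ] DiffOp E M :=
    LinearEquiv.ofBijective (quantization hsmooth ħ)
      ⟨quantization_injective hsmooth hħ, quantization_surjective hsmooth hħ⟩
  have hQ : ∀ (r : ℕ) (Φ : SymTensorField E M r),
      Q (DirectSum.lof ℂ ℕ (fun j => SymTensorField E M j) r Φ) = quantizationHom hsmooth ħ r Φ :=
    fun r Φ => quantization_lof hsmooth r Φ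
  refine ⟨Q, fun r Φ f x => ?_, fun r P hP => ?_⟩
  · rw [hQ]
    rfl
  · obtain ⟨Φ, hΦ, hsum⟩ := IsDiffOpOfOrder.exists_eq_sum hsmooth hħ hP
    have hPQ : P = Q (∑ j ∈ Finset.range (r + 1),
        DirectSum.lof ℂ ℕ (fun j => SymTensorField E M j) j (Φ j)) :=
      Subtype.ext (hsum.trans (quantization_sum_lof hsmooth Φ _).symm)
    refine ⟨Φ, fun j => ?_, hΦ, ?_, fun k _ hk => ?_, ?_⟩
    · rw [hPQ, LinearEquiv.symm_apply_apply]
      exact DirectSum.sum_range_lof_apply Φ hΦ j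
    · rw [hsum]
      exact hasSymbol_sum_range hsmooth Φ r
    · simp only [hQ]
      -- Removing the top `k` components leaves the sum of those of order at most `r - k`, whose
      -- symbol comes from its own top component.
      have hsplit : P.1 - ∑ j ∈ Finset.Ioc (r - k) r, (quantizationHom hsmooth ħ j (Φ j)).1 =
          ∑ j ∈ Finset.range (r - k + 1), (quantizationHom hsmooth ħ j (Φ j)).1 := by
        refine (sub_eq_iff_eq_add (G := Module.End ℂ (SmoothFun E M))).2 ?_
        rw [hsum, ← Finset.sum_range_add_sum_Ico _
          (show r - k + 1 ≤ r + 1 by omega)]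
        congr 2
        ext j
        simp only [Finset.mem_Ico, Finset.mem_Ioc]
        omega
      rw [hsplit]
      exact hasSymbol_sum_range hsmooth Φ (r - k)
    · rw [hPQ, map_sum]
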